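/- Let $\Pi=(S,\Sigma,\mathrm{Pred})$ be a many-sorted first-order signature whose sorts are divided into interpreted sorts, each with a fixed non-empty domain whose elements (the domain elements) may be used as constants, and uninterpreted sorts. Let $\mathcal T$ be a theory over $\Pi$, given by a class of $\Pi$-structures (in which the interpreted sorts denote their fixed domains), let $P\notin\mathrm{Pred}$ be a predicate symbol, and let $\Pi'=(S,\Sigma,\mathrm{Pred}\cup\{P\})$. A constrained $P$-clause $\phi\,\|\,C$ consists of a conjunction $\phi$ of $\Pi$-literals (equations allowed) and a disjunction $C$ of literals $(\neg)P(x_1,\dots,x_n)$ with variables $x_i$; it stands for $\forall\overline x\,(\neg\phi\vee C)$. Ground instances are formed with terms over $\Pi$, the domain elements, and an infinite set of fresh constants for every uninterpreted sort. Let $\succ$ be a strict, well-founded ordering on terms (over this extended signature, with variables; predicate symbols are regarded as function symbols with Boolean values) that is compatible with contexts, stable under substitutions and total on ground terms, such that domain elements are smaller than all other ground terms, and ground atoms $P(\overline t)$ are larger than all ground terms and ground atoms not containing $P$. It is extended to literals and clauses $\neg\phi\vee C$ by multiset extension, where $s\approx t$, $s\not\approx t$, $A$, $\neg A$ are represented by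 $\{s,t\}$, $\{s,s,t,t\}$, $\{A\}$, $\{A,A\}$ (for atoms $A$ that are not equations). The calculus $\mathit{HRes}^P_\succ$ consists of the rules $$\frac{\phi_1\,\|\,P(\overline x)\vee C\qquad \phi_2\,\|\,\neg P(\overline y)\vee D}{(\phi_1\wedge\phi_2)\sigma\,\|\,(C\vee D)\sigma}\qquad\qquad \frac{\phi\,\|\,P(\overline x)\vee P(\overline y)\vee C}{\phi\sigma\,\|\,(P(\overline x)\vee C)\sigma}$$ where $\sigma$ is a most general unifier of $P(\overline x)$ and $P(\overline y)$; in the first rule the premises are variable-disjoint (they may be renamed), $P(\overline x)\sigma$ is strictly maximal in $(P(\overline x)\vee C)\sigma$, and $\neg P(\overline y)\sigma$ is maximal in $(\neg P(\overline y)\vee D)\sigma$; in the second rule $P(\overline x)\sigma$ is maximal in $(P(\overline x)\vee C)\sigma$. Let $\mathcal R^0_c(M)$ be the set of clauses all of whose ground instances $C$ are entailed with respect to $\mathcal T$ by ground instances of clauses in $M$ that are strictly smaller than $C$. Let $\mathcal R_c$ be a map that assigns to every set $M$ of clauses a set $\mathcal R_c(M)\subseteq\mathcal R^0_c(M)$ of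 clauses redundant with respect to $M$. An inference between ground clauses is redundant with respect to $M$ if one of its premises lies in $\mathcal R_c(M)$, or if its conclusion is entailed with respect to $\mathcal T$ by finitely many ground instances of clauses in $M$ that are smaller than its maximal premise. A general inference is redundant if all its ground instances that are $\mathit{HRes}^P_\succ$ inferences are redundant. Let $N$ be a set of constrained $P$-clauses, and let $N^*$ be a saturation of $N$ under $\mathit{HRes}^P_\succ$ up to redundancy: every clause of $N^*$ is derivable from $N$ by $\mathit{HRes}^P_\succ$ (up to renaming of variables), every clause of $N$ belongs to $N^*$ or to $\mathcal R_c(N^*)$, and every $\mathit{HRes}^P_\succ$ inference with premises in $N^*$ is redundant with respect to $N^*$. Let $N^*_0$ be the set of clauses in $N^*$ that do not contain $P$. Then for every model $\mathcal A$ of $\mathcal T$ the following are equivalent: (1) $\mathcal A$ is a model of $N^*_0$; (2) there is a $\Pi'$-structure $\mathcal B$ with $\mathcal B\models N$ and $\mathcal B_{|\Pi}=\mathcal A$ (that is, $\mathcal A\models\exists P\,N$). -/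

import Mathlib

universe u v w

namespace HRes

/-- A many-sorted signature with interpreted sorts `ISort`, each with a fixed non-empty domain
`Dom i`, uninterpreted sorts `USort`, function symbols and predicate symbols. -/
structure Signature where
  ISort : Type u
  USort : Type u
  Dom : ISort → Type w
  dom_nonempty : ∀ i, Nonempty (Dom i)
  Func : Type u
  fdom : Func → List (ISort ⊕ USort)
  fcod : Func → ISort ⊕ USort
  Pred : Type u
  pdom : Pred → List (ISort ⊕ USort)

/-- All sorts of a signature. -/
abbrev Signature.Srt (S : Signature.{u, w}) : Type u := S.ISort ⊕ S.USort

/-- Terms over the signature `S` (with the domain elements of the interpreted sorts as constants),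
extended by a family `K` of fresh constants of the uninterpreted sorts;
there are countably many variables of each sort. -/
inductive Trm (S : Signature.{u, w}) (K : S.USort → Type v) : S.Srt → Type (max u v w)
  | var (s : S.Srt) (n : ℕ) : Trm S K s
  | dom (i : S.ISort) (d : S.Dom i) : Trm S K (Sum.inl i)
  | fresh (j : S.USort) (c : K j) : Trm S K (Sum.inr j)
  | app (f : S.Func) (args : ∀ k : Fin (S.fdom f).length, Trm S K ((S.fdom f).get k)) :
      Trm S K (S.fcod f)

/-- Tuples of terms with the sorts listed in `l`. -/
abbrev Args (S : Signature.{u, w}) (K : S.USort → Type v) (l : List S.Srt) :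
    Type (max u v w) :=
  ∀ k : Fin l.length, Trm S K (l.get k)

/-- Substitutions. -/
abbrev Sub (S : Signature.{u, w}) (K : S.USort → Type v) : Type (max u v w) :=
  ∀ s : S.Srt, ℕ → Trm S K s

/-- Background atoms: equations between terms of the same sort, and atoms `p(t₁, …, tₙ)` for
a predicate symbol `p` of the signature. -/
inductive BAtom (S : Signature.{u, w}) (K : S.USort → Type v) : Type (max u v w)
  | eq (s : S.Srt) (t t' : Trm S K s) : BAtom S K
  | pred (p : S.Pred) (args : Args S K (S.pdom p)) : BAtom S K

/-- Background literals; the Boolean is the polarity (`true` for a positive literal). -/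
abbrev BLit (S : Signature.{u, w}) (K : S.USort → Type v) : Type (max u v w) :=
  Bool × BAtom S K

/-- Literals `P(t₁, …, tₙ)` and `¬ P(t₁, …, tₙ)` for the additional predicate symbol `P`, whose
argument sorts are listed in `ar`. -/
abbrev PLit (S : Signature.{u, w}) (K : S.USort → Type v) (ar : List S.Srt) :
    Type (max u v w) :=
  Bool × Args S K ar

/-- A constrained clause `φ || C`: `φ` is the conjunction of the literals in `constraint`, and
`C` is the disjunction of the literals in `plits`. It stands for the universal closure of
the clause `¬φ ∨ C`. -/
@[ext]
structure Clause (S : Signature.{u, w}) (K : S.USort → Type v) (ar : List S.Srt) :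
    Type (max u v w) where
  constraint : Multiset (BLit S K)
  plits : Multiset (PLit S K ar)

section Substitution

variable {S : Signature.{u, w}} {K : S.USort → Type v} {ar : List S.Srt}

/-- Application of a substitution to a term. -/
def Trm.subst (σ : Sub S K) : {s : S.Srt} → Trm S K s → Trm S K s
  | _, .var s n => σ s n
  | _, .dom i d => .dom i d
  | _, .fresh j c => .fresh j c
  | _, .app f args => .app f fun k => (args k).subst σ

/-- The variables that occur in a term. -/
def Trm.vars : {s : S.Srt} → Trm S K s → Set (S.Srt × ℕ)
  | _, .var s n => {(s, n)}
  | _, .dom _ _ => ∅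
  | _, .fresh _ _ => ∅
  | _, .app _ args => ⋃ k, (args k).vars

/-- The term contains none of the fresh constants. -/
def Trm.NoFresh : {s : S.Srt} → Trm S K s → Prop
  | _, .var _ _ => True
  | _, .dom _ _ => True
  | _, .fresh _ _ => False
  | _, .app _ args => ∀ k, (args k).NoFresh

/-- Application of a substitution to a tuple of terms. -/
def Args.subst (σ : Sub S K) {l : List S.Srt} (a : Args S K l) : Args S K l :=
  fun k => (a k).subst σ

/-- Application of a substitution to a background atom. -/
def BAtom.subst (σ : Sub S K) : BAtom S K → BAtom S K
  | .eq s t t' => .eq s (t.subst σ) (t'.subst σ)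
  | .pred p args => .pred p (Args.subst σ args)

/-- The variables of a background atom. -/
def BAtom.vars : BAtom S K → Set (S.Srt × ℕ)
  | .eq _ t t' => t.vars ∪ t'.vars
  | .pred _ args => ⋃ k, (args k).vars

/-- The background atom contains none of the fresh constants. -/
def BAtom.NoFresh : BAtom S K → Prop
  | .eq _ t t' => t.NoFresh ∧ t'.NoFresh
  | .pred _ args => ∀ k, (args k).NoFresh

/-- Application of a substitution to a `P`-literal. -/
def substP (σ : Sub S K) (L : PLit S K ar) : PLit S K ar :=
  (L.1, Args.subst σ L.2)

/-- Application of a substitution to a constrained clause. -/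
def Clause.subst (σ : Sub S K) (C : Clause S K ar) : Clause S K ar where
  constraint := C.constraint.map fun L => (L.1, L.2.subst σ)
  plits := C.plits.map (substP σ)

/-- The variables of a constrained clause. -/
def Clause.vars (C : Clause S K ar) : Set (S.Srt × ℕ) :=
  {x | (∃ L ∈ C.constraint, x ∈ L.2.vars) ∨ ∃ L ∈ C.plits, ∃ k, x ∈ (L.2 k).vars}

/-- A constrained `P`-clause over the signature: the constraint contains no fresh constants, and
all `P`-literals have the form `P(x₁, …, xₙ)` or `¬ P(x₁, …, xₙ)` with (not necessarily
distinct) variables `x₁, …, xₙ`. -/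
def Clause.IsPClause (C : Clause S K ar) : Prop :=
  (∀ L ∈ C.constraint, L.2.NoFresh) ∧ ∀ L ∈ C.plits, ∀ k, ∃ n, L.2 k = .var (ar.get k) n

/-- The substitution replaces every variable by a ground term. -/
def Sub.Ground (τ : Sub S K) : Prop := ∀ s n, (τ s n).vars = ∅

/-- The set of all ground instances of clauses in `N`. -/
def groundInstances (N : Set (Clause S K ar)) : Set (Clause S K ar) :=
  {D | ∃ C ∈ N, ∃ τ : Sub S K, τ.Ground ∧ D = C.subst τ}

/-- `D` arises from `C` by renaming the variables. -/
def IsVariant (C D : Clause S K ar) : Prop :=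
  ∃ ρ : S.Srt → Equiv.Perm ℕ, D = C.subst fun s n => .var s (ρ s n)

/-- `σ` is a most general unifier of `P(x)` and `P(y)`. -/
def IsMGU (σ : Sub S K) (x y : Args S K ar) : Prop :=
  Args.subst σ x = Args.subst σ y ∧
    ∀ τ : Sub S K, Args.subst τ x = Args.subst τ y →
      ∃ ρ : Sub S K, ∀ s n, τ s n = (σ s n).subst ρ

end Substitution

/-- Structures over the signature `S`; the carriers of the interpreted sorts are the fixed
domains. -/
structure Struct (S : Signature.{u, w}) where
  univ : S.USort → Type w
  univ_nonempty : ∀ j, Nonempty (univ j)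
  func : ∀ f : S.Func,
    (∀ k : Fin (S.fdom f).length, Sum.elim S.Dom univ ((S.fdom f).get k)) →
      Sum.elim S.Dom univ (S.fcod f)
  pred : ∀ p : S.Pred,
    (∀ k : Fin (S.pdom p).length, Sum.elim S.Dom univ ((S.pdom p).get k)) → Prop

/-- The carrier of a sort. -/
abbrev Struct.Carrier {S : Signature.{u, w}} (A : Struct S) : S.Srt → Type w :=
  Sum.elim S.Dom A.univ

/-- Structures over the signature `S` extended by the predicate symbol `P` with argument sorts
`ar`. The reduct to `S` is `toStruct`. -/
structure PStruct (S : Signature.{u, w}) (ar : List S.Srt) extends Struct S where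
  predP : (∀ k : Fin ar.length, toStruct.Carrier (ar.get k)) → Prop

section Semantics

variable {S : Signature.{u, w}} {K : S.USort → Type v} {ar : List S.Srt}

/-- The value of a term, given an interpretation `ι` of the fresh constants and a valuation `β` of
the variables. Domain elements denote themselves. -/
def Trm.eval (A : Struct S) (ι : ∀ j, K j → A.univ j) (β : ∀ s, ℕ → A.Carrier s) :
    {s : S.Srt} → Trm S K s → A.Carrier s
  | _, .var s n => β s n
  | _, .dom _ d => d
  | _, .fresh j c => ι j c
  | _, .app f args => A.func f fun k => (args k).eval A ι β

/-- Truth of a background atom. -/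
def BAtom.Holds (A : Struct S) (ι : ∀ j, K j → A.univ j) (β : ∀ s, ℕ → A.Carrier s) :
    BAtom S K → Prop
  | .eq _ t t' => t.eval A ι β = t'.eval A ι β
  | .pred p args => A.pred p fun k => (args k).eval A ι β

/-- A literal with polarity `b` whose atom has the truth value `p` is true. -/
def litTrue (b : Bool) (p : Prop) : Prop := if b then p else ¬ p

/-- Truth of a constraint (a conjunction of background literals). -/
def constraintHolds (A : Struct S) (ι : ∀ j, K j → A.univ j) (β : ∀ s, ℕ → A.Carrier s)
    (φ : Multiset (BLit S K)) : Prop :=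
  ∀ L ∈ φ, litTrue L.1 (L.2.Holds A ι β)

/-- Truth of (the universal closure of) a constrained clause `φ || C`, i.e. of `¬φ ∨ C`, for
a given interpretation of the fresh constants. -/
def PStruct.Sat (B : PStruct S ar) (ι : ∀ j, K j → B.univ j) (C : Clause S K ar) : Prop :=
  ∀ β : ∀ s, ℕ → B.toStruct.Carrier s, constraintHolds B.toStruct ι β C.constraint →
    ∃ L ∈ C.plits, litTrue L.1 (B.predP fun k => (L.2 k).eval B.toStruct ι β)

/-- `B` is a model of `N`. (For clauses without fresh constants `ι` plays no role.) -/
def PStruct.Models (B : PStruct S ar) (N : Set (Clause S K ar)) : Prop :=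
  ∀ C ∈ N, ∀ ι, B.Sat ι C

/-- `A` is a model of (the universal closures of) the `P`-free clauses `φ || ⊥` with `φ ∈ M`. -/
def Struct.Models (A : Struct S) (M : Set (Multiset (BLit S K))) : Prop :=
  ∀ φ ∈ M, ∀ (ι : ∀ j, K j → A.univ j) (β : ∀ s, ℕ → A.Carrier s), ¬ constraintHolds A ι β φ

/-- The clauses `φ || ⊥` of `N` that do not contain `P`, given by their constraints `φ`. -/
def withoutP (N : Set (Clause S K ar)) : Set (Multiset (BLit S K)) :=
  {φ | (⟨φ, 0⟩ : Clause S K ar) ∈ N}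

/-- Entailment `M ⊨_T C` with respect to the theory `T`, given by its class of models. The fresh
constants are interpreted arbitrarily, and in the same way in `M` and in `C`. -/
def Entails (T : Set (Struct S)) (M : Set (Clause S K ar)) (C : Clause S K ar) : Prop :=
  ∀ B : PStruct S ar, B.toStruct ∈ T → ∀ ι, (∀ D ∈ M, B.Sat ι D) → B.Sat ι C

end Semantics

/-- The expressions compared by the term ordering: terms and non-equational atoms (that is, terms
whose topmost symbol is a predicate symbol, regarded as a function symbol with Boolean values). -/
inductive Ob (S : Signature.{u, w}) (K : S.USort → Type v) (ar : List S.Srt) :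
    Type (max u v w)
  | term (s : S.Srt) (t : Trm S K s) : Ob S K ar
  | pred (p : S.Pred) (args : Args S K (S.pdom p)) : Ob S K ar
  | predP (args : Args S K ar) : Ob S K ar

section Ordering

variable {S : Signature.{u, w}} {K : S.USort → Type v} {ar : List S.Srt}

/-- Application of a substitution. -/
def Ob.subst (σ : Sub S K) : Ob S K ar → Ob S K ar
  | .term s t => .term s (t.subst σ)
  | .pred p args => .pred p (Args.subst σ args)
  | .predP args => .predP (Args.subst σ args)

/-- The expression contains no variables. -/
def Ob.Ground : Ob S K ar → Prop
  | .term _ t => t.vars = ∅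
  | .pred _ args => ∀ k, (args k).vars = ∅
  | .predP args => ∀ k, (args k).vars = ∅

/-- The orderings `≻` admitted by the calculus. -/
structure IsAdmissible (gt : Ob S K ar → Ob S K ar → Prop) : Prop where
  trans : ∀ a b c, gt a b → gt b c → gt a c
  wf : WellFounded fun a b => gt b a
  /-- compatibility with contexts -/
  ctx_func : ∀ (f : S.Func) (args : Args S K (S.fdom f)) (k : Fin (S.fdom f).length)
    (t : Trm S K ((S.fdom f).get k)), gt (.term _ (args k)) (.term _ t) →
      gt (.term _ (.app f args)) (.term _ (.app f (Function.update args k t)))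
  ctx_pred : ∀ (p : S.Pred) (args : Args S K (S.pdom p)) (k : Fin (S.pdom p).length)
    (t : Trm S K ((S.pdom p).get k)), gt (.term _ (args k)) (.term _ t) →
      gt (.pred p args) (.pred p (Function.update args k t))
  ctx_predP : ∀ (args : Args S K ar) (k : Fin ar.length)
    (t : Trm S K (ar.get k)), gt (.term _ (args k)) (.term _ t) →
      gt (.predP args) (.predP (Function.update args k t))
  /-- stability under substitutions -/
  stable : ∀ (σ : Sub S K) (a b : Ob S K ar), gt a b → gt (a.subst σ) (b.subst σ)
  /-- totality on ground expressions -/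
  total : ∀ a b : Ob S K ar, a.Ground → b.Ground → gt a b ∨ a = b ∨ gt b a
  /-- domain elements are smaller than all other ground expressions -/
  dom_min : ∀ (i : S.ISort) (d : S.Dom i) (a : Ob S K ar), a.Ground →
    (∀ (i' : S.ISort) (d' : S.Dom i'), a ≠ .term _ (.dom i' d')) → gt a (.term _ (.dom i d))
  /-- `P` is the largest symbol -/
  predP_term : ∀ (args : Args S K ar) (s : S.Srt) (t : Trm S K s),
    (Ob.predP args).Ground → (Ob.term s t : Ob S K ar).Ground → gt (.predP args) (.term s t)
  predP_pred : ∀ (args : Args S K ar) (p : S.Pred) (a : Args S K (S.pdom p)),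
    (Ob.predP args).Ground → (Ob.pred p a : Ob S K ar).Ground → gt (.predP args) (.pred p a)

/-- The multiset extension of an ordering: `mulGt gt X Y` says that `Y` arises from `X` by
replacing (once or more often) an element by finitely many smaller ones. -/
def mulGt {α : Type*} (gt : α → α → Prop) (X Y : Multiset α) : Prop :=
  Relation.TransGen (Relation.CutExpand fun a b => gt b a) Y X

/-- The multiset of the topmost expressions of a background atom. -/
def BAtom.weight : BAtom S K → Multiset (Ob S K ar)
  | .eq s t t' => {.term s t, .term s t'}
  | .pred p args => {.pred p args}

/-- The multiset that represents a literal in the literal ordering; `m` represents the atom, and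
a negative literal counts it twice. -/
def litWeight {α : Type*} (b : Bool) (m : Multiset α) : Multiset α := if b then m else m + m

/-- The multiset that represents a `P`-literal. -/
def pWeight (L : PLit S K ar) : Multiset (Ob S K ar) := litWeight L.1 {.predP L.2}

/-- The multiset that represents the clause `¬φ ∨ C`: the literals of the constraint `φ` are
negated. -/
def Clause.weight (C : Clause S K ar) : Multiset (Multiset (Ob S K ar)) :=
  C.constraint.map (fun L => litWeight (!L.1) L.2.weight) + C.plits.map pWeight

/-- The ordering on `P`-literals. -/
def litGt (gt : Ob S K ar → Ob S K ar → Prop) (L L' : PLit S K ar) : Prop :=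
  mulGt gt (pWeight L) (pWeight L')

/-- The ordering on constrained clauses. -/
def clauseGt (gt : Ob S K ar → Ob S K ar → Prop) (C D : Clause S K ar) : Prop :=
  mulGt (mulGt gt) C.weight D.weight

/-- `L` is maximal in the clause `L ∨ M`. -/
def IsMax (gt : Ob S K ar → Ob S K ar → Prop) (L : PLit S K ar) (M : Multiset (PLit S K ar)) :
    Prop :=
  ∀ L' ∈ M, ¬ litGt gt L' L

/-- `L` is strictly maximal in the clause `L ∨ M`. -/
def IsStrictMax (gt : Ob S K ar → Ob S K ar → Prop) (L : PLit S K ar)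
    (M : Multiset (PLit S K ar)) : Prop :=
  ∀ L' ∈ M, L' ≠ L ∧ ¬ litGt gt L' L

end Ordering

section Calculus

variable {S : Signature.{u, w}} {K : S.USort → Type v} {ar : List S.Srt}

/-- The inferences of the calculus: `Inference gt premises σ conclusion` is an inference with
most general unifier `σ`. The premises of a resolution inference have no common variables. -/
inductive Inference (gt : Ob S K ar → Ob S K ar → Prop) :
    List (Clause S K ar) → Sub S K → Clause S K ar → Prop
  | resolution (φ₁ φ₂ : Multiset (BLit S K)) (x y : Args S K ar)
      (C D : Multiset (PLit S K ar)) (σ : Sub S K)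
      (disjoint : Disjoint (Clause.vars ⟨φ₁, (true, x) ::ₘ C⟩)
        (Clause.vars ⟨φ₂, (false, y) ::ₘ D⟩))
      (mgu : IsMGU σ x y)
      (max₁ : IsStrictMax gt (substP σ (true, x)) (C.map (substP σ)))
      (max₂ : IsMax gt (substP σ (false, y)) (D.map (substP σ))) :
      Inference gt [⟨φ₁, (true, x) ::ₘ C⟩, ⟨φ₂, (false, y) ::ₘ D⟩] σ
        (Clause.subst σ ⟨φ₁ + φ₂, C + D⟩)
  | factorization (φ : Multiset (BLit S K)) (x y : Args S K ar)
      (C : Multiset (PLit S K ar)) (σ : Sub S K)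
      (mgu : IsMGU σ x y)
      (max : IsMax gt (substP σ (true, x)) (C.map (substP σ))) :
      Inference gt [⟨φ, (true, x) ::ₘ (true, y) ::ₘ C⟩] σ
        (Clause.subst σ ⟨φ, (true, x) ::ₘ C⟩)

/-- The clauses that can be derived from `N` by finitely many inferences (the premises may be
renamed). -/
inductive Derivable (gt : Ob S K ar → Ob S K ar → Prop) (N : Set (Clause S K ar)) :
    Clause S K ar → Prop
  | base (C : Clause S K ar) : C ∈ N → Derivable gt N C
  | rename (C D : Clause S K ar) : Derivable gt N C → IsVariant C D → Derivable gt N D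
  | infer (prems : List (Clause S K ar)) (σ : Sub S K) (C : Clause S K ar) :
      (∀ D ∈ prems, Derivable gt N D) → Inference gt prems σ C → Derivable gt N C

/-- The standard redundancy criterion for clauses: all ground instances of the clause are
entailed with respect to `T` by strictly smaller ground instances of clauses in `N`. -/
def standardRedundant (T : Set (Struct S)) (gt : Ob S K ar → Ob S K ar → Prop)
    (N : Set (Clause S K ar)) : Set (Clause S K ar) :=
  {C | ∀ τ : Sub S K, τ.Ground →
    Entails T {D | D ∈ groundInstances N ∧ clauseGt gt (C.subst τ) D} (C.subst τ)}

/-- Redundancy of a ground inference with respect to `N`: a premise is redundant, or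
the conclusion is entailed with respect to `T` by finitely many ground instances of clauses in `N`
that are smaller than the maximal premise (i.e. smaller than some premise). -/
def RedundantGroundInference (T : Set (Struct S)) (gt : Ob S K ar → Ob S K ar → Prop)
    (Rc : Set (Clause S K ar) → Set (Clause S K ar)) (N : Set (Clause S K ar))
    (prems : List (Clause S K ar)) (C : Clause S K ar) : Prop :=
  (∃ D ∈ prems, D ∈ Rc N) ∨
    ∃ F : Set (Clause S K ar), F.Finite ∧ F ⊆ groundInstances N ∧
      (∀ D ∈ F, ∃ E ∈ prems, clauseGt gt E D) ∧ Entails T F C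

/-- An inference is redundant if all its ground instances (that are inferences of the calculus)
are redundant. -/
def RedundantInference (T : Set (Struct S)) (gt : Ob S K ar → Ob S K ar → Prop)
    (Rc : Set (Clause S K ar) → Set (Clause S K ar)) (N : Set (Clause S K ar))
    (prems : List (Clause S K ar)) (σ : Sub S K) (C : Clause S K ar) : Prop :=
  ∀ τ : Sub S K, τ.Ground →
    (∃ σ', Inference gt (prems.map fun D => (D.subst σ).subst τ) σ' (C.subst τ)) →
      RedundantGroundInference T gt Rc N (prems.map fun D => (D.subst σ).subst τ) (C.subst τ)

/-- `N` is saturated up to redundancy: every inference whose premises are (renamed) clauses of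
`N` is redundant. -/
def IsSaturated (T : Set (Struct S)) (gt : Ob S K ar → Ob S K ar → Prop)
    (Rc : Set (Clause S K ar) → Set (Clause S K ar)) (N : Set (Clause S K ar)) : Prop :=
  ∀ (prems : List (Clause S K ar)) (σ : Sub S K) (C : Clause S K ar),
    (∀ D ∈ prems, ∃ D' ∈ N, IsVariant D' D) → Inference gt prems σ C →
      RedundantInference T gt Rc N prems σ C

/-- `N'` is a saturation of `N` up to redundancy: it consists of clauses derived from `N`, only
redundant clauses of `N` have been removed, and `N'` is saturated up to redundancy. -/
structure IsSaturationOf (T : Set (Struct S)) (gt : Ob S K ar → Ob S K ar → Prop)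
    (Rc : Set (Clause S K ar) → Set (Clause S K ar)) (N N' : Set (Clause S K ar)) : Prop where
  derivable : ∀ C ∈ N', Derivable gt N C
  removed : ∀ C ∈ N, C ∈ N' ∨ C ∈ Rc N'
  saturated : IsSaturated T gt Rc N'

end Calculus

end HRes

/-! If `A` expands to a model of `N`, soundness makes every derivable clause true, in particular the
`P`-free clauses of the saturation (`Derivable.sound`).

For the converse, fix an interpretation `ι` of the fresh constants in `A` and run a
Bachmair–Ganzinger model construction relative to `A`. Each value denoted by a ground term has a
unique least ground term, its normal form (`exists_normal`, `Normal.eq`). Derivable clauses have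
only variables as arguments of `P` (`Derivable.hasVarArgs`), so under a normal substitution all
their `P`-atoms have normal arguments; distinct atoms then speak about distinct tuples of `A`, and
no equality reasoning on `P`-atoms is needed. Normalizing a ground instance preserves its truth
value and does not make it larger (`ge_subst_weight`).

The interpretation `cand` is defined by recursion on `P`-atoms: an atom is true iff a normal
instance with true constraint produces it, that is, the atom is strictly maximal in the clause,
occurs positively, and all other `P`-literals are false. A minimal counterexample
(`sat_of_forall_smaller`) is neither redundant nor `P`-free, the latter since `A` satisfies the
`P`-free clauses. So it can be resolved with a producing clause, can be factored, or is itself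
productive. The inference is redundant by saturation, and its conclusion, which is false, would
follow from smaller true instances. The redundancy criterion also admits redundant premises; this
case is excluded by choosing a minimal producing clause (`MinProduces.not_redundant`).

This yields, for every `ι`, a choice of `P` satisfying all ground instances of `N`. But `A` may have
elements that no ground term denotes, and possibly more elements than there are fresh constants. An
ultrafilter on the interpretations `ι` under which every element is almost always denoted glues
these choices into one relation (`exists_models_of_forall_groundInstances`). -/

namespace HRes

/-! ### Multiset extensions of orderings. -/

section MultisetExtension

variable {α β : Type*} {gt : α → α → Prop}

theorem mulGt.trans {X Y Z : Multiset α} (h : mulGt gt X Y) (h' : mulGt gt Y Z) :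
    mulGt gt X Z :=
  Relation.TransGen.trans h' h

theorem mulGt_wf (h : WellFounded fun a b => gt b a) :
    WellFounded fun X Y => mulGt gt Y X :=
  h.cutExpand.transGen

theorem mulGt_asymm (h : WellFounded fun a b => gt b a) {X Y : Multiset α}
    (h₁ : mulGt gt X Y) : ¬ mulGt gt Y X :=
  fun h₂ => (mulGt_wf h).asymmetric _ _ h₁ h₂

theorem mulGt_add_left {X Y : Multiset α} (Z : Multiset α) (h : mulGt gt X Y) :
    mulGt gt (Z + X) (Z + Y) :=
  Relation.TransGen.lift (Z + ·) (fun _ _ h => (Relation.cutExpand_add_left Z).2 h) _ _ h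

theorem mulGt_add_right {X Y : Multiset α} (Z : Multiset α) (h : mulGt gt X Y) :
    mulGt gt (X + Z) (Y + Z) := by
  rw [add_comm X, add_comm Y]
  exact mulGt_add_left Z h

/-- The sufficient condition of Dershowitz and Manna for the multiset extension. -/
theorem mulGt_of_forall_exists {X : Multiset α} (hX : X ≠ 0) (Y Z : Multiset α)
    (h : ∀ y ∈ Y, ∃ x ∈ X, gt x y) : mulGt gt (Z + X) (Z + Y) := by
  classical
  induction X using Multiset.induction generalizing Y Z with
  | empty => exact absurd rfl hX
  | cons x X ih =>
    by_cases hX' : X = 0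
    · subst hX'
      refine Relation.TransGen.single ⟨Y, x, fun y hy => ?_, ?_⟩
      · obtain ⟨x', hx', hg⟩ := h y hy
        rw [Multiset.cons_zero, Multiset.mem_singleton] at hx'
        exact hx' ▸ hg
      · rw [Multiset.cons_zero]; abel
    -- Spend `x` on the elements of `Y` below it; the remaining ones are dominated by `X`.
    · have h₁ : mulGt gt (Z + x ::ₘ X) (Z + Y.filter (gt x) + X) := by
        refine Relation.TransGen.single
          ⟨Y.filter (gt x), x, fun y hy => (Multiset.mem_filter.1 hy).2, ?_⟩
        rw [← Multiset.singleton_add]; abel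
      refine h₁.trans ?_
      have h₂ := ih hX' (Y.filter fun y => ¬ gt x y) (Z + Y.filter (gt x)) fun y hy => by
        obtain ⟨hy, hn⟩ := Multiset.mem_filter.1 hy
        obtain ⟨x', hx', hg⟩ := h y hy
        rcases Multiset.mem_cons.1 hx' with rfl | hx'
        · exact absurd hg hn
        · exact ⟨x', hx', hg⟩
      rwa [add_assoc Z _ (Y.filter _), Multiset.filter_add_not] at h₂

theorem mulGt_of_mem {X Y : Multiset α} {x : α} (hx : x ∈ X) (h : ∀ y ∈ Y, gt x y) :
    mulGt gt X Y := by
  have := mulGt_of_forall_exists (gt := gt) (X := X) (by rintro rfl; simp at hx) Y 0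
    fun y hy => ⟨x, hx, h y hy⟩
  simpa using this

theorem mulGt_map {gt' : β → β → Prop} (f : α → β) (hf : ∀ a b, gt a b → gt' (f a) (f b))
    {X Y : Multiset α} (h : mulGt gt X Y) : mulGt gt' (X.map f) (Y.map f) := by
  refine Relation.TransGen.lift (Multiset.map f) (fun U V hUV => ?_) _ _ h
  obtain ⟨t, a, ht, he⟩ := hUV
  refine ⟨t.map f, f a, ?_, ?_⟩
  · intro b hb
    obtain ⟨c, hc, rfl⟩ := Multiset.mem_map.1 hb
    exact hf _ _ (ht c hc)
  · simpa using congrArg (Multiset.map f) he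

/-- The reflexive closure of an ordering. -/
def Ge (gt : α → α → Prop) (a b : α) : Prop := a = b ∨ gt a b

theorem Ge.trans_gt {a b c : α} (ht : ∀ a b c, gt a b → gt b c → gt a c) (h : Ge gt b c)
    (h' : gt a b) : gt a c := by
  rcases h with rfl | h
  exacts [h', ht _ _ _ h' h]

theorem Ge.mulGt_add {X X' Y Y' : Multiset α} (h : Ge (mulGt gt) X X')
    (h' : Ge (mulGt gt) Y Y') : Ge (mulGt gt) (X + Y) (X' + Y') := by
  rcases h with rfl | h <;> rcases h' with rfl | h'
  · exact Or.inl rfl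
  · exact Or.inr (mulGt_add_left _ h')
  · exact Or.inr (mulGt_add_right _ h)
  · exact Or.inr ((mulGt_add_right _ h).trans (mulGt_add_left _ h'))

theorem Ge.mulGt_singleton {a b : α} (h : Ge gt a b) :
    Ge (mulGt gt) ({a} : Multiset α) {b} := by
  rcases h with rfl | h
  · exact Or.inl rfl
  · exact Or.inr (mulGt_of_mem (Multiset.mem_singleton_self a) (by simpa using h))

theorem Ge.mulGt_map {ι : Type*} {M : Multiset ι} {f g : ι → α}
    (h : ∀ i ∈ M, Ge gt (f i) (g i)) : Ge (mulGt gt) (M.map f) (M.map g) := by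
  induction M using Multiset.induction with
  | empty => exact Or.inl rfl
  | cons i M ih =>
    rw [Multiset.map_cons, Multiset.map_cons, ← Multiset.singleton_add,
      ← Multiset.singleton_add (g i)]
    exact (h i (Multiset.mem_cons_self i M)).mulGt_singleton.mulGt_add
      (ih fun j hj => h j (Multiset.mem_cons_of_mem hj))

theorem Ge.litWeight {b : Bool} {X Y : Multiset α} (h : Ge (mulGt gt) X Y) :
    Ge (mulGt gt) (litWeight b X) (litWeight b Y) := by
  cases b
  · exact h.mulGt_add h
  · exact h

theorem mem_litWeight {b : Bool} {X : Multiset α} {a : α} : a ∈ litWeight b X ↔ a ∈ X := by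
  cases b <;> simp [HRes.litWeight]

theorem litWeight_map (f : α → β) (b : Bool) (X : Multiset α) :
    (HRes.litWeight b X).map f = HRes.litWeight b (X.map f) := by
  cases b <;> simp [HRes.litWeight]

end MultisetExtension

/-! ### Substitutions, unification of variable tuples, renaming. -/

section Substitution

variable {S : Signature.{u, w}} {K : S.USort → Type v} {ar : List S.Srt}

theorem Trm.subst_subst (σ τ : Sub S K) {s : S.Srt} (t : Trm S K s) :
    (t.subst σ).subst τ = t.subst fun s n => (σ s n).subst τ := by
  induction t with
  | app f args ih => simp only [Trm.subst, ih]
  | _ => simp only [Trm.subst]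

theorem Trm.subst_var {s : S.Srt} (t : Trm S K s) : t.subst (fun s n => .var s n) = t := by
  induction t with
  | app f args ih => simp only [Trm.subst, ih]
  | _ => simp only [Trm.subst]

theorem Trm.subst_congr {σ τ : Sub S K} {s : S.Srt} (t : Trm S K s)
    (h : ∀ x ∈ t.vars, σ x.1 x.2 = τ x.1 x.2) : t.subst σ = t.subst τ := by
  induction t with
  | app f args ih =>
    simp only [Trm.subst]
    congr 1
    funext k
    exact ih k fun x hx => h x (Set.mem_iUnion.2 ⟨k, hx⟩)
  | var s n => exact h (s, n) rfl
  | _ => simp only [Trm.subst]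

theorem Trm.mem_vars_subst {σ : Sub S K} {s : S.Srt} (t : Trm S K s) {x : S.Srt × ℕ} :
    x ∈ (t.subst σ).vars ↔ ∃ y ∈ t.vars, x ∈ (σ y.1 y.2).vars := by
  induction t with
  | app f args ih =>
    simp only [Trm.subst, Trm.vars, Set.mem_iUnion, ih]
    constructor
    · rintro ⟨k, y, hy, h⟩
      exact ⟨y, ⟨k, hy⟩, h⟩
    · rintro ⟨y, ⟨k, hy⟩, h⟩
      exact ⟨k, y, hy, h⟩
  | _ => simp [Trm.subst, Trm.vars]

theorem Trm.vars_subst_ground {τ : Sub S K} (hτ : τ.Ground) {s : S.Srt} (t : Trm S K s) :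
    (t.subst τ).vars = ∅ := by
  ext x
  simp [Trm.mem_vars_subst, hτ _ _]

theorem Trm.finite_vars {s : S.Srt} (t : Trm S K s) : t.vars.Finite := by
  induction t with
  | app f args ih => exact Set.finite_iUnion ih
  | var s n => exact Set.finite_singleton _
  | _ => exact Set.finite_empty

theorem Args.subst_subst (σ τ : Sub S K) {l : List S.Srt} (a : Args S K l) :
    Args.subst τ (Args.subst σ a) = Args.subst (fun s n => (σ s n).subst τ) a :=
  funext fun k => (a k).subst_subst σ τ

theorem Args.subst_var {l : List S.Srt} (a : Args S K l) :
    Args.subst (fun s n => .var s n) a = a :=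
  funext fun k => (a k).subst_var

theorem BAtom.finite_vars (a : BAtom S K) : a.vars.Finite := by
  cases a with
  | eq s t t' => exact t.finite_vars.union t'.finite_vars
  | pred p args => exact Set.finite_iUnion fun k => (args k).finite_vars

theorem BAtom.subst_subst (σ τ : Sub S K) (a : BAtom S K) :
    (a.subst σ).subst τ = a.subst fun s n => (σ s n).subst τ := by
  cases a <;> simp only [BAtom.subst, Args.subst_subst, Trm.subst_subst]

theorem BAtom.subst_var (a : BAtom S K) : a.subst (fun s n => .var s n) = a := by
  cases a <;> simp only [BAtom.subst, Args.subst_var, Trm.subst_var]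

theorem BAtom.subst_congr {σ τ : Sub S K} (a : BAtom S K)
    (h : ∀ x ∈ a.vars, σ x.1 x.2 = τ x.1 x.2) : a.subst σ = a.subst τ := by
  cases a with
  | eq s t t' =>
    simp only [BAtom.subst]
    rw [t.subst_congr fun x hx => h x (Or.inl hx), t'.subst_congr fun x hx => h x (Or.inr hx)]
  | pred p args =>
    simp only [BAtom.subst]
    congr 1
    funext k
    exact (args k).subst_congr fun x hx => h x (Set.mem_iUnion.2 ⟨k, hx⟩)

theorem BAtom.mem_vars_subst {σ : Sub S K} (a : BAtom S K) {x : S.Srt × ℕ} :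
    x ∈ (a.subst σ).vars ↔ ∃ y ∈ a.vars, x ∈ (σ y.1 y.2).vars := by
  cases a with
  | eq s t t' =>
    simp only [BAtom.subst, BAtom.vars, Set.mem_union, Trm.mem_vars_subst, or_and_right, exists_or]
  | pred p args =>
    simp only [BAtom.subst, BAtom.vars, Set.mem_iUnion, Args.subst, Trm.mem_vars_subst]
    constructor
    · rintro ⟨k, y, hy, h⟩
      exact ⟨y, ⟨k, hy⟩, h⟩
    · rintro ⟨y, ⟨k, hy⟩, h⟩
      exact ⟨k, y, hy, h⟩

theorem substP_substP (σ τ : Sub S K) (L : PLit S K ar) :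
    substP τ (substP σ L) = substP (fun s n => (σ s n).subst τ) L := by
  simp only [substP, Args.subst_subst]

theorem substP_var (L : PLit S K ar) : substP (fun s n => .var s n) L = L := by
  simp only [substP, Args.subst_var]

theorem Clause.subst_subst (σ τ : Sub S K) (C : Clause S K ar) :
    (C.subst σ).subst τ = C.subst fun s n => (σ s n).subst τ := by
  simp only [Clause.subst, Multiset.map_map, Function.comp_def, BAtom.subst_subst, substP_substP]

theorem Clause.subst_var (C : Clause S K ar) : C.subst (fun s n => .var s n) = C := by
  simp only [Clause.subst, BAtom.subst_var, substP_var, Multiset.map_id']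

theorem Clause.subst_congr {σ τ : Sub S K} (C : Clause S K ar)
    (h : ∀ x ∈ C.vars, σ x.1 x.2 = τ x.1 x.2) : C.subst σ = C.subst τ := by
  simp only [Clause.subst]
  congr 1
  · refine Multiset.map_congr rfl fun L hL => ?_
    rw [L.2.subst_congr fun x hx => h x (Or.inl ⟨L, hL, hx⟩)]
  · refine Multiset.map_congr rfl fun L hL => ?_
    simp only [substP, Prod.mk.injEq, true_and]
    funext k
    exact (L.2 k).subst_congr fun x hx => h x (Or.inr ⟨L, hL, k, hx⟩)

theorem Clause.finite_vars (C : Clause S K ar) : C.vars.Finite := by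
  classical
  have h₁ : {x | ∃ L ∈ C.constraint, x ∈ L.2.vars}.Finite := by
    have : {x | ∃ L ∈ C.constraint, x ∈ L.2.vars} = ⋃ L ∈ C.constraint.toFinset, L.2.vars := by
      ext; simp
    rw [this]
    exact Set.Finite.biUnion (Finset.finite_toSet _) fun L _ => L.2.finite_vars
  have h₂ : {x | ∃ L ∈ C.plits, ∃ k, x ∈ (L.2 k).vars}.Finite := by
    have : {x | ∃ L ∈ C.plits, ∃ k, x ∈ (L.2 k).vars} =
        ⋃ L ∈ C.plits.toFinset, ⋃ k, (L.2 k).vars := by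
      ext; simp
    rw [this]
    exact Set.Finite.biUnion (Finset.finite_toSet _) fun L _ =>
      Set.finite_iUnion fun k => (L.2 k).finite_vars
  exact h₁.union h₂

theorem Clause.mem_vars_subst {σ : Sub S K} (C : Clause S K ar) {x : S.Srt × ℕ}
    (hx : x ∈ (C.subst σ).vars) : ∃ y ∈ C.vars, x ∈ (σ y.1 y.2).vars := by
  rcases hx with ⟨L, hL, hx⟩ | ⟨L, hL, k, hx⟩
  · obtain ⟨M, hM, rfl⟩ := Multiset.mem_map.1 hL
    obtain ⟨y, hy, h⟩ := (BAtom.mem_vars_subst _).1 hx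
    exact ⟨y, Or.inl ⟨M, hM, hy⟩, h⟩
  · obtain ⟨M, hM, rfl⟩ := Multiset.mem_map.1 hL
    obtain ⟨y, hy, h⟩ := (Trm.mem_vars_subst _).1 hx
    exact ⟨y, Or.inr ⟨M, hM, k, hy⟩, h⟩

theorem Clause.vars_subst_ground {τ : Sub S K} (hτ : τ.Ground) (C : Clause S K ar) :
    (C.subst τ).vars = ∅ := by
  refine Set.eq_empty_of_forall_notMem fun x hx => ?_
  obtain ⟨y, -, h⟩ := C.mem_vars_subst hx
  simp [hτ _ _] at h

theorem IsVariant.refl (C : Clause S K ar) : IsVariant C C :=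
  ⟨fun _ => Equiv.refl ℕ, C.subst_var.symm⟩

/-- All `P`-literals have the form `P(x₁, …, xₙ)` or `¬ P(x₁, …, xₙ)`. -/
def Clause.HasVarArgs (C : Clause S K ar) : Prop :=
  ∀ L ∈ C.plits, ∀ k, ∃ n, L.2 k = .var (ar.get k) n

theorem Clause.HasVarArgs.subst {C : Clause S K ar} (hC : C.HasVarArgs) {σ : Sub S K}
    (hσ : ∀ s n, ∃ m, σ s n = .var s m) : (C.subst σ).HasVarArgs := by
  intro L hL k
  obtain ⟨M, hM, rfl⟩ := Multiset.mem_map.1 hL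
  obtain ⟨n, hn⟩ := hC M hM k
  obtain ⟨m, hm⟩ := hσ (ar.get k) n
  refine ⟨m, ?_⟩
  simp only [substP, Args.subst, hn, Trm.subst]
  exact hm

/-- The equations between variables that a unifier of `P(x)` and `P(y)` has to satisfy. -/
def varEqs (x y : Args S K ar) (s : S.Srt) (n m : ℕ) : Prop :=
  ∃ k, ∃ h : ar.get k = s, h ▸ x k = Trm.var s n ∧ h ▸ y k = Trm.var s m

/-- Variables are replaced by representatives of their classes modulo `varEqs`. -/
noncomputable def varMGU (x y : Args S K ar) : Sub S K := fun s n =>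
  .var s (Quotient.out (Quotient.mk (Relation.EqvGen.setoid (varEqs x y s)) n))

/-- A unifier is constant on the classes of variables that must be identified, so it factors through
`varMGU` with itself as second factor. Lifting uses this form: the same ground substitution
instantiates the lifted inference. -/
theorem subst_varMGU {x y : Args S K ar} {τ : Sub S K} (h : Args.subst τ x = Args.subst τ y)
    (s : S.Srt) (n : ℕ) : (varMGU x y s n).subst τ = τ s n := by
  have key : ∀ n m, Relation.EqvGen (varEqs x y s) n m → τ s n = τ s m := by
    intro n m hnm
    induction hnm with
    | rel n m hr =>
      obtain ⟨k, rfl, hx, hy⟩ := hr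
      have := congrFun h k
      simp only [Args.subst] at this hx hy
      rwa [hx, hy] at this
    | refl => rfl
    | symm _ _ _ ih => exact ih.symm
    | trans _ _ _ _ _ ih₁ ih₂ => exact ih₁.trans ih₂
  exact key _ _ (Quotient.mk_out (s := Relation.EqvGen.setoid (varEqs x y s)) n)

theorem isMGU_varMGU {x y : Args S K ar} (hx : ∀ k, ∃ n, x k = .var (ar.get k) n)
    (hy : ∀ k, ∃ n, y k = .var (ar.get k) n) : IsMGU (varMGU x y) x y := by
  refine ⟨?_, fun τ hτ => ⟨τ, fun s n => (subst_varMGU hτ s n).symm⟩⟩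
  funext k
  obtain ⟨n, hn⟩ := hx k
  obtain ⟨m, hm⟩ := hy k
  simp only [Args.subst, hn, hm, Trm.subst, varMGU]
  congr 2
  exact Quotient.sound (s := Relation.EqvGen.setoid (varEqs x y (ar.get k)))
    (Relation.EqvGen.rel _ _ ⟨k, rfl, hn, hm⟩)

theorem Trm.exists_eq_var_of_subst {ρ : Sub S K} {s : S.Srt} (t : Trm S K s) {m : ℕ}
    (h : t.subst ρ = .var s m) : ∃ n, t = .var s n := by
  cases t with
  | var s n => exact ⟨n, rfl⟩
  | _ => simp [Trm.subst] at h

/-- `varMGU` is an instance of any other most general unifier, and only a variable can have a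
variable as an instance. -/
theorem IsMGU.exists_eq_var {σ : Sub S K} {x y : Args S K ar} (hσ : IsMGU σ x y)
    (hx : ∀ k, ∃ n, x k = .var (ar.get k) n) (hy : ∀ k, ∃ n, y k = .var (ar.get k) n)
    (s : S.Srt) (n : ℕ) : ∃ m, σ s n = .var s m := by
  obtain ⟨ρ, hρ⟩ := hσ.2 _ (isMGU_varMGU hx hy).1
  exact Trm.exists_eq_var_of_subst _ (hρ s n).symm

/-- Most general unifiers of variable tuples only rename or identify variables. This invariant is
what makes the `P`-atoms of normal instances normal. -/
theorem Derivable.hasVarArgs {gt : Ob S K ar → Ob S K ar → Prop} {N : Set (Clause S K ar)}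
    (hN : ∀ C ∈ N, C.HasVarArgs) {C : Clause S K ar} (h : Derivable gt N C) :
    C.HasVarArgs := by
  induction h with
  | base C hC => exact hN C hC
  | rename C D _ hD ih =>
    obtain ⟨ρ, rfl⟩ := hD
    exact ih.subst fun s n => ⟨_, rfl⟩
  | infer prems σ C _ hC ih =>
    cases hC with
    | resolution φ₁ φ₂ x y C D σ hd hσ h₁ h₂ =>
      have hC := ih _ (List.mem_cons_self ..)
      have hD := ih _ (List.mem_cons_of_mem _ (List.mem_cons_self ..))
      refine Clause.HasVarArgs.subst (fun L hL => ?_) (hσ.exists_eq_var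
        (hC _ (Multiset.mem_cons_self ..)) (hD _ (Multiset.mem_cons_self ..)))
      rcases Multiset.mem_add.1 hL with hL | hL
      · exact hC L (Multiset.mem_cons_of_mem hL)
      · exact hD L (Multiset.mem_cons_of_mem hL)
    | factorization φ x y C σ hσ h₁ =>
      have hC := ih _ (List.mem_cons_self ..)
      refine Clause.HasVarArgs.subst (fun L hL => ?_) (hσ.exists_eq_var
        (hC _ (Multiset.mem_cons_self ..))
        (hC _ (Multiset.mem_cons_of_mem (Multiset.mem_cons_self ..))))
      rcases Multiset.mem_cons.1 hL with rfl | hL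
      · exact hC _ (Multiset.mem_cons_self ..)
      · exact hC L (Multiset.mem_cons_of_mem (Multiset.mem_cons_of_mem hL))

/-- Two clauses have variable-disjoint variants. -/
theorem exists_rename_disjoint (C D : Clause S K ar) :
    ∃ ρ : Equiv.Perm ℕ, ∀ x ∈ D.vars, (x.1, ρ x.2) ∉ C.vars := by
  obtain ⟨N, hN⟩ : ∃ N, ∀ x ∈ C.vars ∪ D.vars, x.2 < N := by
    obtain ⟨b, hb⟩ := ((C.finite_vars.union D.finite_vars).image Prod.snd).bddAbove
    exact ⟨b + 1, fun x hx => Nat.lt_succ_of_le (hb ⟨x, hx, rfl⟩)⟩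
  -- Exchanges the blocks `[0, N)` and `[N, 2N)`; all variables of both clauses have indices in the
  -- first block.
  let f : ℕ → ℕ := fun n => if n < N then n + N else if n < 2 * N then n - N else n
  have hf : Function.Involutive f := by
    intro n
    simp only [f]
    split_ifs <;> omega
  refine ⟨hf.toPerm, fun x hx hx' => ?_⟩
  have h₁ := hN x (Or.inr hx)
  have h₂ := hN _ (Or.inl hx')
  simp only [Function.Involutive.coe_toPerm, f] at h₂
  split_ifs at h₂
  omega

end Substitution

/-! ### Evaluation under substitutions and soundness. -/

section Semantics

variable {S : Signature.{u, w}} {K : S.USort → Type v} {ar : List S.Srt}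

theorem Trm.eval_subst (A : Struct S) (ι : ∀ j, K j → A.univ j) (β : ∀ s, ℕ → A.Carrier s)
    (σ : Sub S K) {s : S.Srt} (t : Trm S K s) :
    (t.subst σ).eval A ι β = t.eval A ι fun s n => (σ s n).eval A ι β := by
  induction t with
  | app f args ih => simp only [Trm.subst, Trm.eval, ih]
  | _ => rfl

theorem Trm.eval_congr (A : Struct S) (ι : ∀ j, K j → A.univ j) {β β' : ∀ s, ℕ → A.Carrier s}
    {s : S.Srt} (t : Trm S K s) (h : ∀ x ∈ t.vars, β x.1 x.2 = β' x.1 x.2) :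
    t.eval A ι β = t.eval A ι β' := by
  induction t with
  | app f args ih =>
    simp only [Trm.eval]
    congr 1
    funext k
    exact ih k fun x hx => h x (Set.mem_iUnion.2 ⟨k, hx⟩)
  | var s n => exact h (s, n) rfl
  | _ => rfl

theorem Trm.eval_ground (A : Struct S) (ι : ∀ j, K j → A.univ j) (β β' : ∀ s, ℕ → A.Carrier s)
    {s : S.Srt} {t : Trm S K s} (h : t.vars = ∅) : t.eval A ι β = t.eval A ι β' :=
  t.eval_congr A ι fun x hx => by simp [h] at hx

theorem Trm.eval_noFresh (A : Struct S) (ι ι' : ∀ j, K j → A.univ j)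
    (β : ∀ s, ℕ → A.Carrier s) {s : S.Srt} (t : Trm S K s) (h : t.NoFresh) :
    t.eval A ι β = t.eval A ι' β := by
  induction t with
  | app f args ih =>
    simp only [Trm.eval]
    congr 1
    funext k
    exact ih k (h k)
  | fresh j c => exact h.elim
  | _ => rfl

theorem BAtom.holds_subst (A : Struct S) (ι : ∀ j, K j → A.univ j)
    (β : ∀ s, ℕ → A.Carrier s) (σ : Sub S K) (a : BAtom S K) :
    (a.subst σ).Holds A ι β ↔ a.Holds A ι fun s n => (σ s n).eval A ι β := by
  cases a <;> simp only [BAtom.subst, BAtom.Holds, Args.subst, Trm.eval_subst]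

theorem BAtom.holds_congr (A : Struct S) (ι : ∀ j, K j → A.univ j)
    {β β' : ∀ s, ℕ → A.Carrier s} (a : BAtom S K) (h : ∀ x ∈ a.vars, β x.1 x.2 = β' x.1 x.2) :
    a.Holds A ι β ↔ a.Holds A ι β' := by
  cases a with
  | eq s t t' =>
    simp only [BAtom.Holds]
    rw [t.eval_congr A ι fun x hx => h x (Or.inl hx),
      t'.eval_congr A ι fun x hx => h x (Or.inr hx)]
  | pred p args =>
    have : (fun k => (args k).eval A ι β) = fun k => (args k).eval A ι β' :=
      funext fun k => (args k).eval_congr A ι fun x hx => h x (Set.mem_iUnion.2 ⟨k, hx⟩)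
    simp only [BAtom.Holds, this]

theorem BAtom.holds_noFresh (A : Struct S) (ι ι' : ∀ j, K j → A.univ j)
    (β : ∀ s, ℕ → A.Carrier s) (a : BAtom S K) (h : a.NoFresh) :
    a.Holds A ι β ↔ a.Holds A ι' β := by
  cases a with
  | eq s t t' =>
    simp only [BAtom.Holds]
    rw [t.eval_noFresh A ι ι' β h.1, t'.eval_noFresh A ι ι' β h.2]
  | pred p args =>
    have : (fun k => (args k).eval A ι β) = fun k => (args k).eval A ι' β :=
      funext fun k => (args k).eval_noFresh A ι ι' β (h k)
    simp only [BAtom.Holds, this]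

theorem constraintHolds_subst (A : Struct S) (ι : ∀ j, K j → A.univ j)
    (β : ∀ s, ℕ → A.Carrier s) (σ : Sub S K) (C : Clause S K ar) :
    constraintHolds A ι β (C.subst σ).constraint ↔
      constraintHolds A ι (fun s n => (σ s n).eval A ι β) C.constraint := by
  simp only [constraintHolds, Clause.subst, Multiset.mem_map, forall_exists_index, and_imp,
    forall_apply_eq_imp_iff₂, BAtom.holds_subst]

theorem PStruct.exists_plits_subst (B : PStruct S ar) (ι : ∀ j, K j → B.univ j)
    (β : ∀ s, ℕ → B.toStruct.Carrier s) (σ : Sub S K) (C : Clause S K ar) :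
    (∃ L ∈ (C.subst σ).plits, litTrue L.1 (B.predP fun k => (L.2 k).eval B.toStruct ι β)) ↔
      ∃ L ∈ C.plits, litTrue L.1
        (B.predP fun k => (L.2 k).eval B.toStruct ι fun s n => (σ s n).eval B.toStruct ι β) := by
  simp only [Clause.subst, Multiset.mem_map, exists_exists_and_eq_and, substP, Args.subst,
    Trm.eval_subst]

/-- Truth of a ground instance. -/
theorem PStruct.sat_subst_ground (B : PStruct S ar) (ι : ∀ j, K j → B.univ j)
    (β : ∀ s, ℕ → B.toStruct.Carrier s) {τ : Sub S K} (hτ : τ.Ground) (C : Clause S K ar) :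
    B.Sat ι (C.subst τ) ↔
      (constraintHolds B.toStruct ι (fun s n => (τ s n).eval B.toStruct ι β) C.constraint →
        ∃ L ∈ C.plits, litTrue L.1
          (B.predP fun k => (L.2 k).eval B.toStruct ι fun s n => (τ s n).eval B.toStruct ι β)) := by
  have h : ∀ β', (fun s n => (τ s n).eval B.toStruct ι β') =
      fun s n => (τ s n).eval B.toStruct ι β := fun β' =>
    funext fun s => funext fun n => Trm.eval_ground _ _ _ _ (hτ s n)
  unfold PStruct.Sat
  simp only [constraintHolds_subst, PStruct.exists_plits_subst, h]
  exact ⟨fun hh => hh β, fun hh _ => hh⟩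

theorem PStruct.Sat.subst {B : PStruct S ar} {ι : ∀ j, K j → B.univ j} {C : Clause S K ar}
    (h : B.Sat ι C) (σ : Sub S K) : B.Sat ι (C.subst σ) := by
  intro β hβ
  rw [PStruct.exists_plits_subst]
  exact h _ ((constraintHolds_subst _ _ _ _ _).1 hβ)

/-- Soundness of the inferences. -/
theorem Inference.sound {gt : Ob S K ar → Ob S K ar → Prop} {prems : List (Clause S K ar)}
    {σ : Sub S K} {C : Clause S K ar} (h : Inference gt prems σ C) {B : PStruct S ar}
    {ι : ∀ j, K j → B.univ j} (hB : ∀ D ∈ prems, B.Sat ι D) : B.Sat ι C := by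
  intro β hβ
  cases h with
  | resolution φ₁ φ₂ x y C D σ hd hσ h₁ h₂ =>
    rw [constraintHolds_subst] at hβ
    rw [PStruct.exists_plits_subst]
    set β' := fun s n => (σ s n).eval B.toStruct ι β
    have hxy : (fun k => (x k).eval B.toStruct ι β') = fun k => (y k).eval B.toStruct ι β' := by
      funext k
      have := congrArg (fun a : Args S K ar => (a k).eval B.toStruct ι β) hσ.1
      simpa only [Args.subst, Trm.eval_subst] using this
    obtain ⟨L, hL, hLt⟩ := hB _ (List.mem_cons_self ..) β'
      fun M hM => hβ M (Multiset.mem_add.2 (Or.inl hM))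
    obtain ⟨L', hL', hLt'⟩ := hB _ (List.mem_cons_of_mem _ (List.mem_cons_self ..)) β'
      fun M hM => hβ M (Multiset.mem_add.2 (Or.inr hM))
    rcases Multiset.mem_cons.1 hL with rfl | hL
    · rcases Multiset.mem_cons.1 hL' with rfl | hL'
      · simp only [litTrue, if_true, hxy] at hLt
        simp only [litTrue] at hLt'
        exact absurd hLt (by simpa using hLt')
      · exact ⟨L', Multiset.mem_add.2 (Or.inr hL'), hLt'⟩
    · exact ⟨L, Multiset.mem_add.2 (Or.inl hL), hLt⟩
  | factorization φ x y C σ hσ h₁ =>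
    rw [constraintHolds_subst] at hβ
    rw [PStruct.exists_plits_subst]
    set β' := fun s n => (σ s n).eval B.toStruct ι β
    have hxy : (fun k => (x k).eval B.toStruct ι β') = fun k => (y k).eval B.toStruct ι β' := by
      funext k
      have := congrArg (fun a : Args S K ar => (a k).eval B.toStruct ι β) hσ.1
      simpa only [Args.subst, Trm.eval_subst] using this
    obtain ⟨L, hL, hLt⟩ := hB _ (List.mem_cons_self ..) β' hβ
    rcases Multiset.mem_cons.1 hL with rfl | hL
    · exact ⟨_, Multiset.mem_cons_self .., hLt⟩
    · rcases Multiset.mem_cons.1 hL with rfl | hL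
      · refine ⟨_, Multiset.mem_cons_self .., ?_⟩
        rw [hxy]
        exact hLt
      · exact ⟨L, Multiset.mem_cons_of_mem hL, hLt⟩

theorem Derivable.sound {gt : Ob S K ar → Ob S K ar → Prop} {N : Set (Clause S K ar)}
    {C : Clause S K ar} (h : Derivable gt N C) {B : PStruct S ar} (hB : B.Models N)
    (ι : ∀ j, K j → B.univ j) : B.Sat ι C := by
  induction h with
  | base C hC => exact hB C hC ι
  | rename C D _ hD ih =>
    obtain ⟨ρ, rfl⟩ := hD
    exact ih.subst _
  | infer prems σ C _ hC ih => exact hC.sound ih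

end Semantics

/-! ### Literal and clause orderings. -/

section Ordering

variable {S : Signature.{u, w}} {K : S.USort → Type v} {ar : List S.Srt}
  {gt : Ob S K ar → Ob S K ar → Prop}

/-- The terms of the tuple contain no variables. -/
def Args.Ground {l : List S.Srt} (a : Args S K l) : Prop := ∀ k, (a k).vars = ∅

theorem Args.ground_subst {τ : Sub S K} (hτ : τ.Ground) {l : List S.Srt} (a : Args S K l) :
    (Args.subst τ a).Ground :=
  fun k => (a k).vars_subst_ground hτ

theorem litGt_subst (hgt : IsAdmissible gt) (σ : Sub S K) {L L' : PLit S K ar}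
    (h : litGt gt L L') : litGt gt (substP σ L) (substP σ L') := by
  have hw : ∀ L : PLit S K ar, pWeight (substP σ L) = (pWeight L).map (Ob.subst σ) := by
    intro L
    simp only [pWeight, litWeight_map, Multiset.map_singleton, substP, Ob.subst]
  unfold litGt
  rw [hw, hw]
  exact mulGt_map _ (hgt.stable σ) h

/-- By stability, a larger literal at the `σ` level would remain larger after applying `τ`. Hence
the ordering restrictions of a ground inference lift. -/
theorem IsMax.of_subst (hgt : IsAdmissible gt) {σ τ : Sub S K}
    (hστ : ∀ L : PLit S K ar, substP τ (substP σ L) = substP τ L) {L : PLit S K ar}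
    {R : Multiset (PLit S K ar)} (h : IsMax gt (substP τ L) (R.map (substP τ))) :
    IsMax gt (substP σ L) (R.map (substP σ)) := by
  intro L' hL' hlt
  obtain ⟨M, hM, rfl⟩ := Multiset.mem_map.1 hL'
  have := litGt_subst hgt τ hlt
  rw [hστ, hστ] at this
  exact h _ (Multiset.mem_map_of_mem _ hM) this

theorem IsStrictMax.of_subst (hgt : IsAdmissible gt) {σ τ : Sub S K}
    (hστ : ∀ L : PLit S K ar, substP τ (substP σ L) = substP τ L) {L : PLit S K ar}
    {R : Multiset (PLit S K ar)} (h : IsStrictMax gt (substP τ L) (R.map (substP τ))) :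
    IsStrictMax gt (substP σ L) (R.map (substP σ)) := by
  intro L' hL'
  refine ⟨?_, IsMax.of_subst hgt hστ (fun M hM => (h M hM).2) L' hL'⟩
  rintro rfl
  obtain ⟨M, hM, hML⟩ := Multiset.mem_map.1 hL'
  have := congrArg (substP τ) hML
  rw [hστ, hστ] at this
  exact (h _ (Multiset.mem_map_of_mem _ hM)).1 this

/-- Context compatibility changes one argument at a time, so the arguments are exchanged along a
growing set of positions. -/
theorem ge_of_forall_args {l : List S.Srt} (F : Args S K l → Ob S K ar)
    (ht : ∀ a b c, gt a b → gt b c → gt a c)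
    (hF : ∀ (args : Args S K l) (k : Fin l.length) (t : Trm S K (l.get k)),
      gt (.term _ (args k)) (.term _ t) → gt (F args) (F (Function.update args k t)))
    {a b : Args S K l} (h : ∀ k, Ge gt (.term _ (a k)) (.term _ (b k))) :
    Ge gt (F a) (F b) := by
  classical
  suffices ∀ s : Finset (Fin l.length), Ge gt (F a) (F (s.piecewise b a)) by
    simpa using this Finset.univ
  intro s
  induction s using Finset.induction_on with
  | empty => exact Or.inl (by simp)
  | insert k s hk ih =>
    rw [Finset.piecewise_insert]
    have hka : s.piecewise b a k = a k := Finset.piecewise_eq_of_notMem _ _ _ hk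
    rcases h k with hE | hG
    · have : b k = s.piecewise b a k := by
        rw [hka]
        injection hE with _ hE
        exact hE.symm
      rw [this, Function.update_eq_self]
      exact ih
    · rw [← hka] at hG
      have := hF _ _ _ hG
      rcases ih with ih | ih
      · exact Or.inr (ih ▸ this)
      · exact Or.inr (ht _ _ _ ih this)

theorem ge_subst_term (hgt : IsAdmissible gt) {τ τ' : Sub S K}
    (h : ∀ s n, Ge gt (.term s (τ s n)) (.term s (τ' s n))) {s : S.Srt} (t : Trm S K s) :
    Ge gt (.term s (t.subst τ)) (.term s (t.subst τ')) := by
  induction t with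
  | var s n => exact h s n
  | app f args ih =>
    exact ge_of_forall_args (fun a => .term _ (.app f a)) hgt.trans
      (fun args k t => hgt.ctx_func f args k t) ih
  | _ => exact Or.inl rfl

/-- Allows ground instances to be replaced by normal ones without leaving the range of an induction
hypothesis on smaller clauses. -/
theorem ge_subst_weight (hgt : IsAdmissible gt) {τ τ' : Sub S K}
    (h : ∀ s n, Ge gt (.term s (τ s n)) (.term s (τ' s n))) (C : Clause S K ar) :
    Ge (mulGt (mulGt gt)) (C.subst τ).weight (C.subst τ').weight := by
  simp only [Clause.weight, Clause.subst, Multiset.map_map, Function.comp_def]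
  refine Ge.mulGt_add (Ge.mulGt_map fun L _ => Ge.litWeight ?_)
    (Ge.mulGt_map fun L _ => Ge.litWeight ?_)
  · cases L.2 with
    | eq s t t' =>
      exact (ge_subst_term hgt h t).mulGt_singleton.mulGt_add
        (ge_subst_term hgt h t').mulGt_singleton
    | pred p args =>
      exact (ge_of_forall_args (.pred p) hgt.trans (fun a k t => hgt.ctx_pred p a k t)
        fun k => ge_subst_term hgt h (args k)).mulGt_singleton
  · exact (ge_of_forall_args .predP hgt.trans (fun a k t => hgt.ctx_predP a k t)
      fun k => ge_subst_term hgt h (L.2 k)).mulGt_singleton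

theorem litGt_of_gt {a b : Args S K ar} (h : gt (.predP a) (.predP b)) (p q : Bool) :
    litGt gt (p, a) (q, b) := by
  refine mulGt_of_mem (x := .predP a) (mem_litWeight.2 (Multiset.mem_singleton_self _)) ?_
  intro y hy
  rw [Multiset.mem_singleton.1 (mem_litWeight.1 hy)]
  exact h

theorem litGt_neg_pos (a : Args S K ar) : litGt gt (false, a) (true, a) := by
  simpa [litGt, pWeight, litWeight] using
    mulGt_of_forall_exists (gt := gt) (Multiset.singleton_ne_zero (.predP a)) 0 {.predP a}
      (by simp)

theorem litGt_asymm (hgt : IsAdmissible gt) {L L' : PLit S K ar} (h : litGt gt L L') :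
    ¬ litGt gt L' L :=
  mulGt_asymm hgt.wf h

theorem clauseGt_asymm (hgt : IsAdmissible gt) {C D : Clause S K ar} (h : clauseGt gt C D) :
    ¬ clauseGt gt D C :=
  mulGt_asymm (mulGt_wf hgt.wf) h

theorem clauseGt_wf (hgt : IsAdmissible gt) :
    WellFounded fun C D : Clause S K ar => clauseGt gt D C :=
  InvImage.wf Clause.weight (mulGt_wf (mulGt_wf hgt.wf))

/-- `P`-atoms are larger than all literals of the constraint. -/
theorem mulGt_pWeight_of_mem_weight (hgt : IsAdmissible gt) {E : Clause S K ar}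
    (hE : E.vars = ∅) {L : PLit S K ar} (hL : L.2.Ground)
    (h : ∀ L' ∈ E.plits, litGt gt L L') : ∀ m ∈ E.weight, mulGt gt (pWeight L) m := by
  intro m hm
  rcases Multiset.mem_add.1 hm with hm | hm
  · obtain ⟨M, hM, rfl⟩ := Multiset.mem_map.1 hm
    have hMv : M.2.vars = ∅ := Set.eq_empty_of_forall_notMem fun x hx => by
      have : x ∈ E.vars := Or.inl ⟨M, hM, hx⟩
      simp [hE] at this
    refine mulGt_of_mem (x := .predP L.2) (mem_litWeight.2 (Multiset.mem_singleton_self _)) ?_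
    intro o ho
    rw [mem_litWeight] at ho
    revert hMv ho
    cases M.2 with
    | eq s t t' =>
      intro hMv ho
      simp only [BAtom.vars, Set.union_empty_iff] at hMv
      simp only [BAtom.weight, Multiset.insert_eq_cons, Multiset.mem_cons,
        Multiset.mem_singleton] at ho
      rcases ho with rfl | rfl
      · exact hgt.predP_term _ _ _ hL hMv.1
      · exact hgt.predP_term _ _ _ hL hMv.2
    | pred p args =>
      intro hMv ho
      simp only [BAtom.vars, Set.iUnion_eq_empty] at hMv
      rw [Multiset.mem_singleton.1 ho]
      exact hgt.predP_pred _ _ _ hL hMv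
  · obtain ⟨M, hM, rfl⟩ := Multiset.mem_map.1 hm
    exact h M hM

theorem clauseGt_of_mem_plits (hgt : IsAdmissible gt) {D E : Clause S K ar} (hE : E.vars = ∅)
    {L : PLit S K ar} (hLD : L ∈ D.plits) (hL : L.2.Ground)
    (h : ∀ L' ∈ E.plits, litGt gt L L') : clauseGt gt D E :=
  mulGt_of_mem (Multiset.mem_add.2 (Or.inr (Multiset.mem_map_of_mem _ hLD)))
    (mulGt_pWeight_of_mem_weight hgt hE hL h)

/-- Cancel one copy of `L` on both sides; the second copy in `D` dominates everything left of `E`.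
-/
theorem clauseGt_of_duplicate (hgt : IsAdmissible gt) {D E : Clause S K ar} (hE : E.vars = ∅)
    {L : PLit S K ar} {R R' : Multiset (PLit S K ar)} (hD : D.plits = L ::ₘ L ::ₘ R)
    (hE' : E.plits = L ::ₘ R') (hL : L.2.Ground) (h : ∀ L' ∈ R', litGt gt L L') :
    clauseGt gt D E := by
  have hDw : D.weight = {pWeight L} + Clause.weight ⟨D.constraint, L ::ₘ R⟩ := by
    simp only [Clause.weight, hD, Multiset.map_cons]
    rw [Multiset.singleton_add, ← Multiset.add_cons]
  have hEw : E.weight = {pWeight L} + Clause.weight ⟨E.constraint, R'⟩ := by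
    simp only [Clause.weight, hE', Multiset.map_cons]
    rw [Multiset.singleton_add, ← Multiset.add_cons]
  have hv : (⟨E.constraint, R'⟩ : Clause S K ar).vars = ∅ := by
    refine Set.eq_empty_of_forall_notMem fun x hx => ?_
    have : x ∈ E.vars := by
      rcases hx with hx | ⟨M, hM, hx⟩
      · exact Or.inl hx
      · exact Or.inr ⟨M, hE' ▸ Multiset.mem_cons_of_mem hM, hx⟩
    simp [hE] at this
  unfold clauseGt
  rw [hDw, hEw]
  have hmem : pWeight L ∈ (⟨D.constraint, L ::ₘ R⟩ : Clause S K ar).weight :=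
    Multiset.mem_add.2 (Or.inr (Multiset.mem_map_of_mem _ (Multiset.mem_cons_self ..)))
  refine mulGt_of_forall_exists (fun h0 => ?_) _ _ fun m hm =>
    ⟨_, hmem, mulGt_pWeight_of_mem_weight hgt hv hL h m hm⟩
  rw [h0] at hmem
  exact Multiset.notMem_zero _ hmem

theorem mem_groundInstances {N : Set (Clause S K ar)} {C : Clause S K ar} (hC : C ∈ N)
    {τ : Sub S K} (hτ : τ.Ground) : C.subst τ ∈ groundInstances N :=
  ⟨C, hC, τ, hτ, rfl⟩

theorem Clause.subst_eq_self {C : Clause S K ar} (hC : C.vars = ∅) (τ : Sub S K) :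
    C.subst τ = C := by
  conv_rhs => rw [← C.subst_var]
  exact C.subst_congr fun x hx => by simp [hC] at hx

theorem isMGU_self (x : Args S K ar) : IsMGU (fun s n => .var s n) x x :=
  ⟨rfl, fun τ _ => ⟨τ, fun _ _ => rfl⟩⟩

/-! ### Lifting ground inferences to saturated sets. -/

section Lifting

variable {T : Set (Struct S)} {Rc : Set (Clause S K ar) → Set (Clause S K ar)}
  {M : Set (Clause S K ar)}

theorem IsSaturated.resolution_of_disjoint (hgt : IsAdmissible gt) (hM : IsSaturated T gt Rc M)
    {φ₁ φ₂ : Multiset (BLit S K)} {x y : Args S K ar} {R₁ R₂ : Multiset (PLit S K ar)}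
    {C₁ C₂ : Clause S K ar} (hC₁ : C₁ ∈ M) (hC₂ : C₂ ∈ M)
    (hv₁ : IsVariant C₁ ⟨φ₁, (true, x) ::ₘ R₁⟩) (hv₂ : IsVariant C₂ ⟨φ₂, (false, y) ::ₘ R₂⟩)
    (hx : ∀ k, ∃ n, x k = .var (ar.get k) n) (hy : ∀ k, ∃ n, y k = .var (ar.get k) n)
    (hd : Disjoint (Clause.vars ⟨φ₁, (true, x) ::ₘ R₁⟩) (Clause.vars ⟨φ₂, (false, y) ::ₘ R₂⟩))
    {τ : Sub S K} (hτ : τ.Ground) (hxy : Args.subst τ x = Args.subst τ y)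
    (h₁ : IsStrictMax gt (substP τ (true, x)) (R₁.map (substP τ)))
    (h₂ : IsMax gt (substP τ (false, y)) (R₂.map (substP τ))) :
    RedundantGroundInference T gt Rc M
      [Clause.subst τ ⟨φ₁, (true, x) ::ₘ R₁⟩, Clause.subst τ ⟨φ₂, (false, y) ::ₘ R₂⟩]
      (Clause.subst τ ⟨φ₁ + φ₂, R₁ + R₂⟩) := by
  have hστ : (fun s n => (varMGU x y s n).subst τ) = τ :=
    funext fun s => funext fun n => subst_varMGU hxy s n
  have hL : ∀ L : PLit S K ar, substP τ (substP (varMGU x y) L) = substP τ L := fun L => by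
    rw [substP_substP, hστ]
  have hC : ∀ C : Clause S K ar, (C.subst (varMGU x y)).subst τ = C.subst τ := fun C => by
    rw [Clause.subst_subst, hστ]
  have := hM _ _ _ (by
      intro D hD
      simp only [List.mem_cons, List.not_mem_nil, or_false] at hD
      rcases hD with rfl | rfl
      exacts [⟨_, hC₁, hv₁⟩, ⟨_, hC₂, hv₂⟩])
    (Inference.resolution φ₁ φ₂ x y R₁ R₂ (varMGU x y) hd (isMGU_varMGU hx hy)
      (h₁.of_subst hgt hL) (h₂.of_subst hgt hL)) τ hτ
  simp only [List.map_cons, List.map_nil, hC] at this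
  -- Redundancy only concerns instances that are themselves inferences; here the two resolved atoms
  -- coincide, so the identity is a most general unifier.
  refine this ⟨fun s n => .var s n, ?_⟩
  have hinf := Inference.resolution (gt := gt)
    (φ₁.map fun L => (L.1, L.2.subst τ)) (φ₂.map fun L => (L.1, L.2.subst τ))
    (Args.subst τ x) (Args.subst τ y) (R₁.map (substP τ)) (R₂.map (substP τ))
    (fun s n => .var s n) ?_ (hxy ▸ isMGU_self _) ?_ ?_
  · rw [Clause.subst_var] at hinf
    simpa only [Clause.subst, Multiset.map_cons, Multiset.map_add, substP] using hinf
  · have := Clause.vars_subst_ground hτ (⟨φ₁, (true, x) ::ₘ R₁⟩ : Clause S K ar)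
    rw [Clause.subst, Multiset.map_cons] at this
    exact Set.disjoint_left.2 fun z hz => absurd (this ▸ hz) (Set.notMem_empty z)
  · simp only [substP_var, Multiset.map_id']
    exact h₁
  · simp only [substP_var, Multiset.map_id']
    exact h₂

/-- Lifting of ground resolution inferences. -/
theorem IsSaturated.resolution (hgt : IsAdmissible gt) (hM : IsSaturated T gt Rc M)
    (hMv : ∀ C ∈ M, C.HasVarArgs)
    {C₁ C₂ : Clause S K ar} (hC₁ : C₁ ∈ M) (hC₂ : C₂ ∈ M)
    {x y : Args S K ar} {R₁ R₂ : Multiset (PLit S K ar)}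
    (hp₁ : C₁.plits = (true, x) ::ₘ R₁) (hp₂ : C₂.plits = (false, y) ::ₘ R₂)
    {τ₁ τ₂ : Sub S K} (hτ₁ : τ₁.Ground) (hτ₂ : τ₂.Ground)
    (hxy : Args.subst τ₁ x = Args.subst τ₂ y)
    (h₁ : IsStrictMax gt (substP τ₁ (true, x)) (R₁.map (substP τ₁)))
    (h₂ : IsMax gt (substP τ₂ (false, y)) (R₂.map (substP τ₂))) :
    RedundantGroundInference T gt Rc M [C₁.subst τ₁, C₂.subst τ₂]
      ⟨(C₁.subst τ₁).constraint + (C₂.subst τ₂).constraint,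
        R₁.map (substP τ₁) + R₂.map (substP τ₂)⟩ := by
  classical
  obtain ⟨ρ, hρ⟩ := exists_rename_disjoint C₁ C₂
  let r : Sub S K := fun s n => .var s (ρ n)
  -- Merges both ground substitutions: `τ₁` on the variables of `C₁`, elsewhere `τ₂` after undoing
  -- the renaming of `C₂`.
  let τ : Sub S K := fun s n => if (s, n) ∈ C₁.vars then τ₁ s n else τ₂ s (ρ.symm n)
  have hτ : τ.Ground := by
    intro s n
    simp only [τ]
    split_ifs
    exacts [hτ₁ _ _, hτ₂ _ _]
  have e₁ : C₁.subst τ = C₁.subst τ₁ := C₁.subst_congr fun z hz => if_pos hz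
  have e₂ : (C₂.subst r).subst τ = C₂.subst τ₂ := by
    rw [Clause.subst_subst]
    refine C₂.subst_congr fun z hz => ?_
    simp only [r, Trm.subst, τ, if_neg (hρ z hz), Equiv.symm_apply_apply]
  have p₁ : ∀ L ∈ C₁.plits, substP τ L = substP τ₁ L := fun L hL => by
    simp only [substP, Prod.mk.injEq, true_and]
    funext k
    exact (L.2 k).subst_congr fun z hz => if_pos (Or.inr ⟨L, hL, k, hz⟩)
  have p₂ : ∀ L ∈ C₂.plits, substP τ (substP r L) = substP τ₂ L := fun L hL => by
    rw [substP_substP]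
    simp only [substP, Prod.mk.injEq, true_and]
    funext k
    refine (L.2 k).subst_congr fun z hz => ?_
    simp only [r, Trm.subst, τ, if_neg (hρ z (Or.inr ⟨L, hL, k, hz⟩)), Equiv.symm_apply_apply]
  have m₁ : R₁.map (substP τ) = R₁.map (substP τ₁) := Multiset.map_congr rfl fun L hL =>
    p₁ L (hp₁ ▸ Multiset.mem_cons_of_mem hL)
  have m₂ : (R₂.map (substP r)).map (substP τ) = R₂.map (substP τ₂) := by
    rw [Multiset.map_map]
    exact Multiset.map_congr rfl fun L hL => p₂ L (hp₂ ▸ Multiset.mem_cons_of_mem hL)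
  have q₁ : substP τ (true, x) = substP τ₁ (true, x) :=
    p₁ _ (hp₁ ▸ Multiset.mem_cons_self ..)
  have q₂ : substP τ (false, Args.subst r y) = substP τ₂ (false, y) :=
    p₂ (false, y) (hp₂ ▸ Multiset.mem_cons_self ..)
  have hv₂ : (C₂.subst r).HasVarArgs := (hMv _ hC₂).subst fun s n => ⟨_, rfl⟩
  have hd : Disjoint C₁.vars (C₂.subst r).vars := by
    refine Set.disjoint_right.2 fun z hz => ?_
    obtain ⟨z', hz', hz⟩ := Clause.mem_vars_subst _ hz
    rw [show z = (z'.1, ρ z'.2) from hz]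
    exact hρ z' hz'
  have hC₁e : C₁ = ⟨C₁.constraint, (true, x) ::ₘ R₁⟩ := Clause.ext rfl hp₁
  have hC₂e : C₂.subst r =
      ⟨(C₂.subst r).constraint, (false, Args.subst r y) ::ₘ R₂.map (substP r)⟩ := by
    refine Clause.ext rfl ?_
    simp only [Clause.subst, hp₂, Multiset.map_cons, substP]
  have key := IsSaturated.resolution_of_disjoint hgt hM hC₁ hC₂ (hC₁e ▸ IsVariant.refl C₁)
    (hC₂e ▸ ⟨fun _ => ρ, rfl⟩)
    (hMv _ hC₁ (true, x) (hp₁ ▸ Multiset.mem_cons_self ..))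
    (hv₂ (false, Args.subst r y) (by rw [hC₂e]; exact Multiset.mem_cons_self ..))
    (hC₁e ▸ hC₂e ▸ hd) hτ
    ((congrArg Prod.snd q₁).trans (hxy.trans (congrArg Prod.snd q₂).symm))
    (by rw [q₁, m₁]; exact h₁) (by rw [q₂, m₂]; exact h₂)
  rw [← hC₁e, ← hC₂e, e₁, e₂] at key
  rw [← e₁, ← e₂, ← m₁, ← m₂]
  rw [← e₁, ← e₂] at key
  simpa only [Clause.subst, Multiset.map_add] using key

/-- Lifting of ground factorization inferences. -/
theorem IsSaturated.factorization (hgt : IsAdmissible gt) (hM : IsSaturated T gt Rc M)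
    (hMv : ∀ C ∈ M, C.HasVarArgs) {C : Clause S K ar} (hC : C ∈ M)
    {x y : Args S K ar} {R : Multiset (PLit S K ar)}
    (hp : C.plits = (true, x) ::ₘ (true, y) ::ₘ R)
    {τ : Sub S K} (hτ : τ.Ground) (hxy : Args.subst τ x = Args.subst τ y)
    (h : IsMax gt (substP τ (true, x)) (R.map (substP τ))) :
    RedundantGroundInference T gt Rc M [C.subst τ]
      ⟨(C.subst τ).constraint, (substP τ (true, x)) ::ₘ R.map (substP τ)⟩ := by
  obtain ⟨φ, p⟩ := C
  obtain rfl : p = _ := hp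
  have hx := hMv _ hC (true, x) (Multiset.mem_cons_self ..)
  have hy := hMv _ hC (true, y) (Multiset.mem_cons_of_mem (Multiset.mem_cons_self ..))
  have hστ : (fun s n => (varMGU x y s n).subst τ) = τ :=
    funext fun s => funext fun n => subst_varMGU hxy s n
  have hL : ∀ L : PLit S K ar, substP τ (substP (varMGU x y) L) = substP τ L := fun L => by
    rw [substP_substP, hστ]
  have hC' : ∀ C : Clause S K ar, (C.subst (varMGU x y)).subst τ = C.subst τ := fun C => by
    rw [Clause.subst_subst, hστ]
  have := hM _ _ _ (by
      intro D hD
      rw [List.mem_singleton] at hD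
      exact ⟨_, hC, hD ▸ IsVariant.refl _⟩)
    (Inference.factorization φ x y R (varMGU x y) (isMGU_varMGU hx hy)
      (h.of_subst hgt hL)) τ hτ
  simp only [List.map_cons, List.map_nil, hC'] at this
  simp only [Clause.subst, Multiset.map_cons] at this ⊢
  refine this ⟨fun s n => .var s n, ?_⟩
  have hinf := Inference.factorization (gt := gt)
    (φ.map fun L => (L.1, L.2.subst τ))
    (Args.subst τ x) (Args.subst τ y) (R.map (substP τ))
    (fun s n => .var s n) (hxy ▸ isMGU_self _) ?_
  · rw [Clause.subst_var] at hinf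
    exact hinf
  · simp only [substP_var, Multiset.map_id']
    exact h

end Lifting

end Ordering

/-! ### The candidate model for a fixed interpretation of the fresh constants. -/

section ModelConstruction

variable {S : Signature.{u, w}} {K : S.USort → Type v} {ar : List S.Srt}
  {gt : Ob S K ar → Ob S K ar → Prop} {T : Set (Struct S)}
  {Rc : Set (Clause S K ar) → Set (Clause S K ar)} {M : Set (Clause S K ar)}
  {A : Struct S} {ι : ∀ j, K j → A.univ j} {β : ∀ s, ℕ → A.Carrier s}

/-- The ground term `t` is minimal among the ground terms with the same value. -/
def Normal (gt : Ob S K ar → Ob S K ar → Prop) (A : Struct S) (ι : ∀ j, K j → A.univ j)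
    (β : ∀ s, ℕ → A.Carrier s) {s : S.Srt} (t : Trm S K s) : Prop :=
  t.vars = ∅ ∧ ∀ t' : Trm S K s, t'.vars = ∅ → t'.eval A ι β = t.eval A ι β →
    ¬ gt (.term s t) (.term s t')

theorem exists_normal (hgt : IsAdmissible gt) {s : S.Srt} {t : Trm S K s} (ht : t.vars = ∅) :
    ∃ t', Normal gt A ι β t' ∧ t'.eval A ι β = t.eval A ι β ∧
      Ge gt (.term s t) (.term s t') := by
  have hwf : WellFounded fun a b : Trm S K s => gt (.term s b) (.term s a) :=
    InvImage.wf (Ob.term s) hgt.wf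
  obtain ⟨t', ⟨h₁, h₂⟩, h₃⟩ := hwf.has_min
    {t' : Trm S K s | t'.vars = ∅ ∧ t'.eval A ι β = t.eval A ι β} ⟨t, ht, rfl⟩
  refine ⟨t', ⟨h₁, fun t'' h h' => h₃ t'' ⟨h, h'.trans h₂⟩⟩, h₂, ?_⟩
  rcases hgt.total (.term s t) (.term s t') ht h₁ with h | h | h
  exacts [Or.inr h, Or.inl h, absurd h (h₃ t ⟨ht, rfl⟩)]

/-- Totality on ground terms leaves one normal form per value, so truth values may be assigned to
tuples of normal forms independently. -/
theorem Normal.eq (hgt : IsAdmissible gt) {s : S.Srt} {t t' : Trm S K s}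
    (h : Normal gt A ι β t) (h' : Normal gt A ι β t') (he : t.eval A ι β = t'.eval A ι β) :
    t = t' := by
  rcases hgt.total (.term s t) (.term s t') h.1 h'.1 with h₁ | h₁ | h₁
  · exact absurd h₁ (h.2 t' h'.1 he.symm)
  · injection h₁
  · exact absurd h₁ (h'.2 t h.1 he)

/-- All terms of the tuple are in normal form. -/
def Args.Normal (gt : Ob S K ar → Ob S K ar → Prop) (A : Struct S) (ι : ∀ j, K j → A.univ j)
    (β : ∀ s, ℕ → A.Carrier s) {l : List S.Srt} (a : Args S K l) : Prop :=
  ∀ k, HRes.Normal gt A ι β (a k)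

/-- The substitution replaces every variable by a term in normal form. -/
def Sub.Normal (gt : Ob S K ar → Ob S K ar → Prop) (A : Struct S) (ι : ∀ j, K j → A.univ j)
    (β : ∀ s, ℕ → A.Carrier s) (τ : Sub S K) : Prop :=
  ∀ s n, HRes.Normal gt A ι β (τ s n)

theorem Sub.Normal.ground {τ : Sub S K} (h : τ.Normal gt A ι β) : τ.Ground :=
  fun s n => (h s n).1

theorem Sub.Normal.args {τ : Sub S K} (h : τ.Normal gt A ι β) {C : Clause S K ar}
    (hC : C.HasVarArgs) {L : PLit S K ar} (hL : L ∈ C.plits) :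
    (Args.subst τ L.2).Normal gt A ι β := by
  intro k
  obtain ⟨n, hn⟩ := hC L hL k
  simp only [Args.subst, hn, Trm.subst]
  exact h _ _

theorem Sub.Ground.exists_normal (hgt : IsAdmissible gt) {τ : Sub S K} (hτ : τ.Ground) :
    ∃ τ' : Sub S K, τ'.Normal gt A ι β ∧
      (∀ s n, (τ' s n).eval A ι β = (τ s n).eval A ι β) ∧
      ∀ s n, Ge gt (.term s (τ s n)) (.term s (τ' s n)) := by
  choose τ' h₁ h₂ h₃ using fun s n =>
    HRes.exists_normal (A := A) (ι := ι) (β := β) hgt (hτ s n)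
  exact ⟨τ', h₁, h₂, h₃⟩

/-- The expansion of `A` in which the true `P`-atoms are given by the tuples of normal forms
with property `J`. -/
abbrev expansion (gt : Ob S K ar → Ob S K ar → Prop) (A : Struct S) (ι : ∀ j, K j → A.univ j)
    (β : ∀ s, ℕ → A.Carrier s) (J : Args S K ar → Prop) : PStruct S ar where
  toStruct := A
  predP e := ∃ b : Args S K ar, b.Normal gt A ι β ∧ (fun k => (b k).eval A ι β) = e ∧ J b

theorem expansion_predP (hgt : IsAdmissible gt) (J : Args S K ar → Prop) {a : Args S K ar}
    (ha : a.Normal gt A ι β) :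
    (expansion gt A ι β J).predP (fun k => (a k).eval A ι β) ↔ J a := by
  constructor
  · rintro ⟨b, hb, he, hJ⟩
    have : b = a := funext fun k => (hb k).eq hgt (ha k) (congrFun he k)
    exact this ▸ hJ
  · exact fun h => ⟨a, ha, rfl, h⟩

theorem sat_expansion (hgt : IsAdmissible gt) (J : Args S K ar → Prop) {C : Clause S K ar}
    (hC : C.HasVarArgs) {τ : Sub S K} (hτ : τ.Normal gt A ι β) :
    (expansion gt A ι β J).Sat ι (C.subst τ) ↔
      (constraintHolds A ι (fun s n => (τ s n).eval A ι β) C.constraint →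
        ∃ L ∈ C.plits, litTrue L.1 (J (Args.subst τ L.2))) := by
  rw [PStruct.sat_subst_ground _ _ β hτ.ground]
  refine imp_congr Iff.rfl (exists_congr fun L => and_congr_right fun hL => ?_)
  rw [← expansion_predP hgt J (hτ.args hC hL)]
  simp only [Args.subst, Trm.eval_subst]

theorem sat_subst_congr (B : PStruct S ar) (ι : ∀ j, K j → B.univ j)
    (β : ∀ s, ℕ → B.toStruct.Carrier s) {τ τ' : Sub S K} (hτ : τ.Ground) (hτ' : τ'.Ground)
    (h : ∀ s n, (τ' s n).eval B.toStruct ι β = (τ s n).eval B.toStruct ι β)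
    (C : Clause S K ar) : B.Sat ι (C.subst τ') ↔ B.Sat ι (C.subst τ) := by
  rw [B.sat_subst_ground ι β hτ, B.sat_subst_ground ι β hτ']
  simp only [h]

/-- The instance `C τ` produces the atom `P(a)`, given the truth values `I` of the smaller
atoms. -/
def Produces (gt : Ob S K ar → Ob S K ar → Prop) (A : Struct S) (ι : ∀ j, K j → A.univ j)
    (β : ∀ s, ℕ → A.Carrier s) (M : Set (Clause S K ar)) (a : Args S K ar)
    (I : Args S K ar → Prop) (C : Clause S K ar) (τ : Sub S K) : Prop :=
  C ∈ M ∧ τ.Normal gt A ι β ∧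
    constraintHolds A ι (fun s n => (τ s n).eval A ι β) C.constraint ∧
      ∃ x R, C.plits = (true, x) ::ₘ R ∧ Args.subst τ x = a ∧
        ∀ L ∈ R, gt (.predP a) (.predP (Args.subst τ L.2)) ∧
          ¬ litTrue L.1 (I (Args.subst τ L.2))

theorem predP_wf (hgt : IsAdmissible gt) :
    WellFounded fun a b : Args S K ar => gt (.predP b) (.predP a) :=
  InvImage.wf Ob.predP hgt.wf

/-- The candidate interpretation. -/
def cand (hgt : IsAdmissible gt) (A : Struct S) (ι : ∀ j, K j → A.univ j)
    (β : ∀ s, ℕ → A.Carrier s) (M : Set (Clause S K ar)) : Args S K ar → Prop :=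
  (predP_wf hgt).fix fun a ih =>
    ∃ C τ, Produces gt A ι β M a (fun b => ∃ h : gt (.predP a) (.predP b), ih b h) C τ

/-- The part of the candidate interpretation below the atom `P(a)`. -/
def candBelow (hgt : IsAdmissible gt) (A : Struct S) (ι : ∀ j, K j → A.univ j)
    (β : ∀ s, ℕ → A.Carrier s) (M : Set (Clause S K ar)) (a b : Args S K ar) : Prop :=
  gt (.predP a) (.predP b) ∧ cand hgt A ι β M b

theorem cand_iff (hgt : IsAdmissible gt) (a : Args S K ar) :
    cand hgt A ι β M a ↔
      ∃ C τ, Produces gt A ι β M a (candBelow hgt A ι β M a) C τ := by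
  conv_lhs => rw [cand, WellFounded.fix_eq]
  simp only [exists_prop]
  exact Iff.rfl

/-- A clause that produces `P(a)` and is minimal with this property. -/
def MinProduces (hgt : IsAdmissible gt) (A : Struct S) (ι : ∀ j, K j → A.univ j)
    (β : ∀ s, ℕ → A.Carrier s) (M : Set (Clause S K ar)) (a : Args S K ar)
    (C : Clause S K ar) (τ : Sub S K) : Prop :=
  Produces gt A ι β M a (candBelow hgt A ι β M a) C τ ∧
    ∀ C' τ', Produces gt A ι β M a (candBelow hgt A ι β M a) C' τ' →
      ¬ clauseGt gt (C.subst τ) (C'.subst τ')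

/-- Minimality is needed because an arbitrary producing clause may be redundant. -/
theorem exists_minProduces (hgt : IsAdmissible gt) {a : Args S K ar}
    (ha : cand hgt A ι β M a) : ∃ C τ, MinProduces hgt A ι β M a C τ := by
  obtain ⟨C₀, τ₀, h₀⟩ := (cand_iff hgt a).1 ha
  obtain ⟨_, ⟨C, τ, h, rfl⟩, hmin⟩ := (clauseGt_wf hgt).has_min
    {E | ∃ C τ, Produces gt A ι β M a (candBelow hgt A ι β M a) C τ ∧ E = C.subst τ}
    ⟨_, C₀, τ₀, h₀, rfl⟩
  exact ⟨C, τ, h, fun C' τ' h' => hmin _ ⟨C', τ', h', rfl⟩⟩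

/-- The produced atom is strictly maximal in its clause and occurs there positively, so its negation
already exceeds every literal. -/
theorem Produces.litGt (hgt : IsAdmissible gt) {I : Args S K ar → Prop} {a : Args S K ar}
    {C : Clause S K ar} {τ : Sub S K} (h : Produces gt A ι β M a I C τ) {L : PLit S K ar}
    (hL : L = (false, a) ∨ gt (.predP L.2) (.predP a)) :
    ∀ L' ∈ (C.subst τ).plits, HRes.litGt gt L L' := by
  obtain ⟨-, -, -, x, R, hp, hx, hR⟩ := h
  intro L' hL'
  simp only [Clause.subst, hp, Multiset.map_cons] at hL'
  rw [Multiset.mem_cons] at hL'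
  rcases hL' with rfl | hL'
  · simp only [substP, hx]
    rcases hL with rfl | hL
    · exact litGt_neg_pos a
    · exact litGt_of_gt hL _ _
  · rw [Multiset.mem_map] at hL'
    obtain ⟨L', hL', rfl⟩ := hL'
    rcases hL with rfl | hL
    · exact litGt_of_gt (hR L' hL').1 _ _
    · exact litGt_of_gt (hgt.trans _ _ _ hL (hR L' hL').1) _ _

theorem gt_irrefl (hgt : IsAdmissible gt) (a : Ob S K ar) : ¬ gt a a :=
  fun h => hgt.wf.asymmetric _ _ h h

/-- The minimal productive clauses are not redundant. -/
theorem MinProduces.not_redundant (hgt : IsAdmissible gt) (hA : A ∈ T)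
    (hMv : ∀ C ∈ M, C.HasVarArgs) {a : Args S K ar} {C : Clause S K ar} {τ : Sub S K}
    (h : MinProduces hgt A ι β M a C τ)
    (hsat : ∀ E ∈ groundInstances M, clauseGt gt (C.subst τ) E →
      (expansion gt A ι β (cand hgt A ι β M)).Sat ι E) :
    C.subst τ ∉ standardRedundant T gt M := by
  intro hred
  obtain ⟨hprod, hmin⟩ := h
  obtain ⟨hCM, hτ, hφ, x, R, hp, hx, hR⟩ := id hprod
  have hvars := C.vars_subst_ground hτ.ground
  have hgr : a.Ground := hx ▸ Args.ground_subst hτ.ground x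
  have hent := hred τ hτ.ground
  rw [Clause.subst_eq_self hvars] at hent
  -- Test the entailment in the interpretation truncated strictly below `a`: there the producing
  -- clause is false, and it remains to see that all smaller instances are true.
  have hC := hent (expansion gt A ι β (candBelow hgt A ι β M a)) hA ι ?_
  · obtain ⟨L, hL, hLt⟩ := (sat_expansion hgt _ (hMv C hCM) hτ).1 hC hφ
    rw [hp] at hL
    rcases Multiset.mem_cons.1 hL with rfl | hL
    · simp only [litTrue, if_true, hx] at hLt
      exact gt_irrefl hgt _ hLt.1
    · exact (hR L hL).2 hLt
  rintro _ ⟨⟨C', hC', τ₀, hτ₀, rfl⟩, hlt⟩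
  obtain ⟨τ', hτ', hev, hge⟩ := hτ₀.exists_normal (A := A) (ι := ι) (β := β) hgt
  have hlt' : clauseGt gt (C.subst τ) (C'.subst τ') :=
    Ge.trans_gt (gt := mulGt (mulGt gt)) (fun _ _ _ => mulGt.trans) (ge_subst_weight hgt hge C') hlt
  refine (sat_subst_congr (expansion gt A ι β _) ι β hτ₀ hτ'.ground hev C').1 ?_
  rw [sat_expansion hgt _ (hMv C' hC') hτ']
  intro hφ'
  obtain ⟨L, hL, hLt⟩ := (sat_expansion hgt _ (hMv C' hC') hτ').1
    (hsat _ (mem_groundInstances hC' hτ'.ground) hlt') hφ'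
  by_contra hno
  push Not at hno
  -- Such a literal would make the instance of `C'` larger than the producing clause. So its atoms
  -- lie below `a`, where both interpretations agree, or equal `a` in positive literals.
  have hnot : ∀ L ∈ C'.plits, ¬ ((Args.subst τ' L.2 = a ∧ L.1 = false) ∨
      gt (.predP (Args.subst τ' L.2)) (.predP a)) := by
    rintro ⟨b, y⟩ hL h
    refine clauseGt_asymm hgt hlt' (clauseGt_of_mem_plits hgt hvars
      (Multiset.mem_map_of_mem (substP τ') hL) (Args.ground_subst hτ'.ground y)
      (hprod.litGt hgt ?_))
    rcases h with ⟨rfl, rfl⟩ | h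
    exacts [Or.inl rfl, Or.inr h]
  have htri : ∀ L ∈ C'.plits, (Args.subst τ' L.2 = a ∧ L.1 = true) ∨
      gt (.predP a) (.predP (Args.subst τ' L.2)) := by
    intro L hL
    have := hnot L hL
    rcases hgt.total (.predP a) (.predP (Args.subst τ' L.2)) hgr
      (Args.ground_subst hτ'.ground L.2) with h | h | h
    · exact Or.inr h
    · injection h with h
      refine Or.inl ⟨h.symm, ?_⟩
      by_contra hb
      exact this (Or.inl ⟨h.symm, by simpa using hb⟩)
    · exact absurd (Or.inr h) this
  rcases htri L hL with ⟨hLa, hLb⟩ | hlt₁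
  · obtain ⟨b, y⟩ := L
    obtain rfl : b = true := hLb
    obtain ⟨R', hR'⟩ := Multiset.exists_cons_of_mem hL
    -- If `C'` is true in `cand` only through `P(a)`, it produces `P(a)` itself, against minimality.
    refine hmin C' τ' ⟨hC', hτ', hφ', y, R', hR', hLa, fun L' hL' => ⟨?_, hno L' ?_⟩⟩ hlt'
    · rcases htri L' (hR' ▸ Multiset.mem_cons_of_mem hL') with ⟨hLa', hLb'⟩ | h
      · exfalso
        obtain ⟨b', y'⟩ := L'
        obtain rfl : b' = true := hLb'
        obtain ⟨R'', hR''⟩ := Multiset.exists_cons_of_mem hL'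
        -- A second copy of `P(a)` would make this instance larger than the producing clause, which
        -- contains only one.
        refine clauseGt_asymm hgt hlt' (clauseGt_of_duplicate hgt hvars (L := (true, a))
          (R := R''.map (substP τ')) (R' := R.map (substP τ)) ?_ ?_ hgr ?_)
        · simp only [Clause.subst, hR', hR'', Multiset.map_cons, substP]
          rw [hLa, hLa']
        · simp only [Clause.subst, hp, Multiset.map_cons, substP, hx]
        · intro L' hL'
          rw [Multiset.mem_map] at hL'
          obtain ⟨L', hL', rfl⟩ := hL'
          exact litGt_of_gt (hR L' hL').1 _ _
      · exact h
    · exact hR' ▸ Multiset.mem_cons_of_mem hL'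
  · refine hno L hL ?_
    have : candBelow hgt A ι β M a (Args.subst τ' L.2) ↔ cand hgt A ι β M (Args.subst τ' L.2) :=
      and_iff_right hlt₁
    rwa [this]

theorem exists_max_plit (hgt : IsAdmissible gt) (τ : Sub S K) {P : Multiset (PLit S K ar)}
    (hP : P ≠ 0) : ∃ L ∈ P, ∀ L' ∈ P,
      ¬ gt (.predP (Args.subst τ L'.2)) (.predP (Args.subst τ L.2)) := by
  induction P using Multiset.induction with
  | empty => exact absurd rfl hP
  | cons L P ih =>
    by_cases hP' : P = 0
    · subst hP'
      refine ⟨L, Multiset.mem_cons_self .., fun L' hL' => ?_⟩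
      rw [Multiset.cons_zero, Multiset.mem_singleton] at hL'
      exact hL' ▸ gt_irrefl hgt _
    · obtain ⟨L₁, hL₁, hmax⟩ := ih hP'
      by_cases h : gt (.predP (Args.subst τ L.2)) (.predP (Args.subst τ L₁.2))
      · refine ⟨L, Multiset.mem_cons_self .., fun L' hL' hlt => ?_⟩
        rcases Multiset.mem_cons.1 hL' with rfl | hL'
        · exact gt_irrefl hgt _ hlt
        · exact hmax L' hL' (hgt.trans _ _ _ hlt h)
      · refine ⟨L₁, Multiset.mem_cons_of_mem hL₁, fun L' hL' => ?_⟩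
        rcases Multiset.mem_cons.1 hL' with rfl | hL'
        exacts [h, hmax L' hL']

/-- The minimal counterexample argument: a false instance would force an inference, at its maximal
atom, whose conclusion is false although it follows from smaller, hence true, instances. -/
theorem sat_of_forall_smaller (hgt : IsAdmissible gt) (hA : A ∈ T)
    (hRc : Rc M ⊆ standardRedundant T gt M) (hMv : ∀ C ∈ M, C.HasVarArgs)
    (hM : IsSaturated T gt Rc M) (hAM : A.Models (withoutP M)) {C : Clause S K ar} (hC : C ∈ M)
    {τ : Sub S K} (hτ : τ.Normal gt A ι β)
    (ih : ∀ E ∈ groundInstances M, clauseGt gt (C.subst τ) E →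
      (expansion gt A ι β (cand hgt A ι β M)).Sat ι E) :
    (expansion gt A ι β (cand hgt A ι β M)).Sat ι (C.subst τ) := by
  have hvars := C.vars_subst_ground hτ.ground
  have hgrd : ∀ a : Args S K ar, (Args.subst τ a).Ground := Args.ground_subst hτ.ground
  by_cases hnr : C.subst τ ∈ standardRedundant T gt M
  · have hent := hnr τ hτ.ground
    rw [Clause.subst_eq_self hvars] at hent
    exact hent (expansion gt A ι β _) hA ι fun E hE => ih E hE.1 hE.2
  by_contra hns
  have hfalse := hns
  rw [sat_expansion hgt _ (hMv C hC) hτ] at hfalse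
  push Not at hfalse
  obtain ⟨hφ, hfalse⟩ := hfalse
  have hne : C.plits ≠ 0 := by
    intro h0
    refine hAM C.constraint ?_ ι _ hφ
    have : C = ⟨C.constraint, 0⟩ := Clause.ext rfl h0
    exact this ▸ hC
  obtain ⟨L₀, hL₀, hmax⟩ := exists_max_plit hgt τ hne
  obtain ⟨a, ha⟩ : ∃ a, a = Args.subst τ L₀.2 := ⟨_, rfl⟩
  rw [← ha] at hmax
  have hgr : a.Ground := ha ▸ hgrd _
  have htri : ∀ L ∈ C.plits, Args.subst τ L.2 = a ∨ gt (.predP a) (.predP (Args.subst τ L.2)) := by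
    intro L hL
    rcases hgt.total (.predP a) (.predP (Args.subst τ L.2)) hgr (hgrd _) with h | h | h
    · exact Or.inr h
    · injection h with h
      exact Or.inl h.symm
    · exact absurd h (hmax L hL)
  have hev : ∀ (C' : Clause S K ar) (τ' : Sub S K), C' ∈ M → τ'.Normal gt A ι β →
      ∀ L ∈ C'.plits, ((expansion gt A ι β (cand hgt A ι β M)).predP
        (fun k => ((substP τ' L).2 k).eval A ι β) ↔ cand hgt A ι β M (Args.subst τ' L.2)) :=
    fun C' τ' hC' hτ' L hL => expansion_predP hgt _ (hτ'.args (hMv C' hC') hL)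
  -- If the maximal atom occurs negatively, it is true in `cand`, and the clause is resolved with a
  -- minimal clause producing it.
  by_cases hneg : ∃ y, (false, y) ∈ C.plits ∧ Args.subst τ y = a
  · obtain ⟨y, hy, hya⟩ := hneg
    obtain ⟨D, hD⟩ := Multiset.exists_cons_of_mem hy
    have hca : cand hgt A ι β M a := by
      have := hfalse _ hy
      simpa [litTrue, hya] using this
    obtain ⟨C₁, τ₁, hmin⟩ := exists_minProduces hgt hca
    -- The producing premise is the smaller one, so the induction hypothesis covers everything below
    -- either premise.
    have hlt : clauseGt gt (C.subst τ) (C₁.subst τ₁) :=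
      clauseGt_of_mem_plits hgt (C₁.vars_subst_ground hmin.1.2.1.ground)
        (Multiset.mem_map_of_mem (substP τ) hy) (hgrd y)
        (hmin.1.litGt hgt (Or.inl (by simp only [substP, hya])))
    have hnr₁ := hmin.not_redundant hgt hA hMv fun E hE hE' => ih E hE (hlt.trans hE')
    obtain ⟨⟨hC₁, hτ₁, hφ₁, x, R, hp, hx, hR⟩, -⟩ := hmin
    have hinf := IsSaturated.resolution hgt hM hMv hC₁ hC hp hD hτ₁.ground hτ.ground
      (hx.trans hya.symm) ?_ ?_
    · rcases hinf with ⟨E, hE, hER⟩ | ⟨F, -, hF, hFlt, hent⟩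
      · simp only [List.mem_cons, List.not_mem_nil, or_false] at hE
        rcases hE with rfl | rfl
        exacts [hnr₁ (hRc hER), hnr (hRc hER)]
      · have hconc := hent (expansion gt A ι β (cand hgt A ι β M)) hA ι fun E hE => by
          obtain ⟨E', hE', hEE'⟩ := hFlt E hE
          simp only [List.mem_cons, List.not_mem_nil, or_false] at hE'
          rcases hE' with rfl | rfl
          · exact ih E (hF hE) (hlt.trans hEE')
          · exact ih E (hF hE) hEE'
        obtain ⟨L, hL, hLt⟩ := hconc β fun L hL => by
          rcases Multiset.mem_add.1 hL with hL | hL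
          · exact (constraintHolds_subst A ι β τ₁ C₁).2 hφ₁ L hL
          · exact (constraintHolds_subst A ι β τ C).2 hφ L hL
        replace hL := Multiset.mem_add.1 hL
        rcases hL with hL | hL
        · rw [Multiset.mem_map] at hL
          obtain ⟨L, hL, rfl⟩ := hL
          refine (hR L hL).2 ?_
          have h₁ := hev C₁ τ₁ hC₁ hτ₁ L (hp ▸ Multiset.mem_cons_of_mem hL)
          have h₂ : candBelow hgt A ι β M a (Args.subst τ₁ L.2) ↔
            cand hgt A ι β M (Args.subst τ₁ L.2) := and_iff_right (hR L hL).1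
          rw [h₂, ← h₁]
          exact hLt
        · rw [Multiset.mem_map] at hL
          obtain ⟨L, hL, rfl⟩ := hL
          have hL' : L ∈ C.plits := hD ▸ Multiset.mem_cons_of_mem hL
          refine hfalse L hL' ?_
          rw [← hev C τ hC hτ L hL']
          exact hLt
    · intro L' hL'
      rw [Multiset.mem_map] at hL'
      obtain ⟨L', hL', rfl⟩ := hL'
      have hg := (hR L' hL').1
      rw [← hx] at hg
      refine ⟨fun he => gt_irrefl hgt (.predP (Args.subst τ₁ x)) ?_,
        litGt_asymm hgt (litGt_of_gt hg _ _)⟩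
      have he' : Args.subst τ₁ L'.2 = Args.subst τ₁ x := congrArg Prod.snd he
      rwa [he'] at hg
    · intro L' hL'
      rw [Multiset.mem_map] at hL'
      obtain ⟨⟨b, z⟩, hL', rfl⟩ := hL'
      rcases htri (b, z) (hD ▸ Multiset.mem_cons_of_mem hL') with h | h
      · simp only [substP, h, hya]
        cases b
        · exact fun h => litGt_asymm hgt h h
        · exact litGt_asymm hgt (litGt_neg_pos a)
      · rw [← hya] at h
        exact litGt_asymm hgt (litGt_of_gt h _ _)
  · have hpos : ∀ L ∈ C.plits, Args.subst τ L.2 = a → L.1 = true := by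
      rintro ⟨b, y⟩ hL hLa
      cases b
      · exact absurd ⟨y, hL, hLa⟩ hneg
      · rfl
    obtain ⟨b, x⟩ := L₀
    obtain rfl : b = true := hpos _ hL₀ ha.symm
    obtain ⟨R, hR⟩ := Multiset.exists_cons_of_mem hL₀
    -- If the positive maximal atom is strictly maximal, the clause produces it and is true after
    -- all; otherwise the atom is repeated and factorization applies.
    by_cases hst : ∀ L ∈ R, gt (.predP a) (.predP (Args.subst τ L.2))
    · refine hfalse _ hL₀ ?_
      simp only [litTrue, if_true]
      rw [cand_iff]
      refine ⟨C, τ, hC, hτ, hφ, x, R, hR, rfl, fun L hL => ?_⟩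
      rw [← ha]
      refine ⟨hst L hL, ?_⟩
      have h₂ : candBelow hgt A ι β M a (Args.subst τ L.2) ↔
        cand hgt A ι β M (Args.subst τ L.2) := and_iff_right (hst L hL)
      rw [h₂]
      exact hfalse L (hR ▸ Multiset.mem_cons_of_mem hL)
    · push Not at hst
      obtain ⟨⟨b, y⟩, hy, hyn⟩ := hst
      have hyC : (b, y) ∈ C.plits := hR ▸ Multiset.mem_cons_of_mem hy
      have hya : Args.subst τ y = a := (htri _ hyC).resolve_right hyn
      obtain rfl : b = true := hpos _ hyC hya
      obtain ⟨R', hR'⟩ := Multiset.exists_cons_of_mem hy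
      subst hR'
      have hinf := IsSaturated.factorization hgt hM hMv hC hR hτ.ground
        (ha.symm.trans hya.symm) ?_
      · rcases hinf with ⟨E, hE, hER⟩ | ⟨F, -, hF, hFlt, hent⟩
        · rw [List.mem_singleton] at hE
          subst hE
          exact hnr (hRc hER)
        · have hconc := hent (expansion gt A ι β (cand hgt A ι β M)) hA ι fun E hE => by
            obtain ⟨E', hE', hEE'⟩ := hFlt E hE
            rw [List.mem_singleton] at hE'
            subst hE'
            exact ih E (hF hE) hEE'
          obtain ⟨L, hL, hLt⟩ := hconc β ((constraintHolds_subst A ι β τ C).2 hφ)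
          rw [← Multiset.map_cons] at hL
          rw [Multiset.mem_map] at hL
          obtain ⟨L, hL, rfl⟩ := hL
          have hL' : L ∈ C.plits := by
            rw [hR]
            rcases Multiset.mem_cons.1 hL with rfl | hL
            · exact Multiset.mem_cons_self ..
            · exact Multiset.mem_cons_of_mem (Multiset.mem_cons_of_mem hL)
          refine hfalse L hL' ?_
          rw [← hev C τ hC hτ L hL']
          exact hLt
      · intro L' hL'
        rw [Multiset.mem_map] at hL'
        obtain ⟨⟨b, z⟩, hL', rfl⟩ := hL'
        have hz : (b, z) ∈ C.plits :=
          hR ▸ Multiset.mem_cons_of_mem (Multiset.mem_cons_of_mem hL')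
        rcases htri _ hz with h | h
        · obtain rfl : b = true := hpos _ hz h
          simp only [substP]
          rw [show Args.subst τ z = a from h, ← ha]
          exact fun h => litGt_asymm hgt h h
        · rw [ha] at h
          exact litGt_asymm hgt (litGt_of_gt h _ _)

/-- The candidate interpretation is a model of all ground instances. -/
theorem sat_groundInstances (hgt : IsAdmissible gt) (hA : A ∈ T)
    (hRc : Rc M ⊆ standardRedundant T gt M) (hMv : ∀ C ∈ M, C.HasVarArgs)
    (hM : IsSaturated T gt Rc M) (hAM : A.Models (withoutP M)) :
    ∀ E ∈ groundInstances M, (expansion gt A ι β (cand hgt A ι β M)).Sat ι E := by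
  intro E
  induction E using (clauseGt_wf hgt).induction with
  | _ E ih =>
    rintro ⟨C, hC, τ₀, hτ₀, rfl⟩
    obtain ⟨τ, hτ, hev, hge⟩ := hτ₀.exists_normal (A := A) (ι := ι) (β := β) hgt
    refine (sat_subst_congr (expansion gt A ι β _) ι β hτ₀ hτ.ground hev C).1 ?_
    -- The normalized instance is no larger than the original, so instances below it are covered by
    -- the induction hypothesis.
    refine sat_of_forall_smaller hgt hA hRc hMv hM hAM hC hτ fun E hE hlt => ih E ?_ hE
    rcases ge_subst_weight hgt hge C with h | h
    · unfold clauseGt at hlt ⊢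
      rwa [h]
    · exact h.trans hlt

/-- Clauses of `N` dropped as redundant are still entailed by ground instances of the saturation.
The valuation `β` serves only to evaluate ground terms. -/
theorem exists_expansion_of_saturation (hgt : IsAdmissible gt) (hA : A ∈ T)
    (hRc : Rc M ⊆ standardRedundant T gt M) {N : Set (Clause S K ar)}
    (hN : ∀ C ∈ N, C.IsPClause) (hM : IsSaturationOf T gt Rc N M)
    (hAM : A.Models (withoutP M)) (ι : ∀ j, K j → A.univ j) (β : ∀ s, ℕ → A.Carrier s) :
    ∃ p, ∀ E ∈ groundInstances N, (⟨A, p⟩ : PStruct S ar).Sat ι E := by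
  have hMv : ∀ C ∈ M, C.HasVarArgs := fun C hC =>
    (hM.derivable C hC).hasVarArgs fun C hC => (hN C hC).2
  have hsat := sat_groundInstances (ι := ι) (β := β) hgt hA hRc hMv hM.saturated hAM
  refine ⟨(expansion gt A ι β (cand hgt A ι β M)).predP, ?_⟩
  rintro _ ⟨C, hC, τ, hτ, rfl⟩
  rcases hM.removed C hC with h | h
  · exact hsat _ (mem_groundInstances h hτ)
  · exact hRc h τ hτ (expansion gt A ι β _) hA ι fun E hE => hsat E hE.1

end ModelConstruction

/-! ### From ground instances to all elements of the structure. -/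

section Compactness

variable {S : Signature.{u, w}} {K : S.USort → Type v} {ar : List S.Srt}

/-- Gives the finite intersection property for the ultrafilter: infinitely many constants can name
any finite set of elements. -/
theorem exists_range_superset {X Y : Type*} [Infinite X] [Nonempty Y] {s : Set Y}
    (hs : s.Finite) : ∃ f : X → Y, s ⊆ Set.range f := by
  obtain ⟨y⟩ := ‹Nonempty Y›
  obtain ⟨g, hg⟩ := (hs.insert y).countable.exists_eq_range (Set.insert_nonempty y s)
  refine ⟨g ∘ Function.invFun (Infinite.natEmbedding X), ?_⟩
  rw [(Function.invFun_surjective (Infinite.natEmbedding X).injective).range_comp, ← hg]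
  exact Set.subset_insert y s

/-- An ultrafilter on the interpretations of the fresh constants that makes every element of an
uninterpreted sort almost always denoted by a fresh constant. -/
theorem exists_ultrafilter_denoting (hK : ∀ j, Infinite (K j)) (A : Struct S) :
    ∃ U : Ultrafilter (∀ j, K j → A.univ j),
      ∀ j (e : A.univ j), ∀ᶠ ι : ∀ j, K j → A.univ j in U, ∃ c, ι j c = e := by
  classical
  obtain ⟨U, hU⟩ := Ultrafilter.exists_ultrafilter_of_finite_inter_nonempty
    (Set.range fun p : Σ j, A.univ j => {ι : ∀ j, K j → A.univ j | ∃ c, ι p.1 c = p.2}) (by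
      intro F hF
      rw [← Set.image_univ] at hF
      obtain ⟨G, -, hG⟩ := Finset.subset_set_image_iff.1 hF
      have : ∀ j, ∃ f : K j → A.univ j, {e | (⟨j, e⟩ : Σ j, A.univ j) ∈ G} ⊆ Set.range f := by
        intro j
        have := hK j
        have := A.univ_nonempty j
        refine exists_range_superset (Set.Finite.subset
          ((G.finite_toSet).preimage (sigma_mk_injective.injOn)) (fun e he => he))
      choose ι hι using this
      refine ⟨ι, ?_⟩
      rintro _ hs
      rw [← hG, Finset.mem_coe, Finset.mem_image] at hs
      obtain ⟨⟨j, e⟩, hp, rfl⟩ := hs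
      exact hι j hp)
  exact ⟨U, fun j e => hU ⟨⟨j, e⟩, rfl⟩⟩

/-- A clause has finitely many variables, so for almost all `ι` a given valuation of them is
realized by a ground instance; the truth of these instances passes to the ultrafilter limit. -/
theorem exists_models_of_forall_groundInstances (hK : ∀ j, Infinite (K j)) (A : Struct S)
    {N : Set (Clause S K ar)} (hN : ∀ C ∈ N, C.IsPClause)
    (h : ∀ ι : ∀ j, K j → A.univ j,
      ∃ p, ∀ E ∈ groundInstances N, (⟨A, p⟩ : PStruct S ar).Sat ι E) :
    ∃ p, (⟨A, p⟩ : PStruct S ar).Models N := by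
  obtain ⟨U, hU⟩ := exists_ultrafilter_denoting hK A
  choose p hp using h
  -- The limit of the relations `p ι` along the ultrafilter, all of them on the same structure `A`.
  refine ⟨fun e => ∀ᶠ ι in U, p ι e, ?_⟩
  intro C hC ι₀ β hφ
  have hden : ∀ s (e : A.Carrier s), ∀ᶠ ι in U,
      ∃ t : Trm S K s, t.vars = ∅ ∧ t.eval A ι β = e := by
    rintro (i | j) e
    · exact Filter.Eventually.of_forall fun ι => ⟨.dom i e, rfl, rfl⟩
    · filter_upwards [hU j e] with ι hι
      obtain ⟨c, hc⟩ := hι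
      exact ⟨.fresh j c, rfl, hc⟩
  have hgr : ∀ s, ∃ t : Trm S K s, t.vars = ∅ := by
    rintro (i | j)
    · obtain ⟨d⟩ := S.dom_nonempty i
      exact ⟨.dom i d, rfl⟩
    · have := hK j
      exact ⟨.fresh j (Classical.arbitrary _), rfl⟩
  have hall : ∀ᶠ ι in U, ∀ x ∈ C.vars, ∃ t : Trm S K x.1, t.vars = ∅ ∧ t.eval A ι β = β x.1 x.2 :=
    (Filter.eventually_all_finite C.finite_vars).2 fun x _ => hden x.1 _
  -- The arguments can be evaluated with the fixed `ι₀`, being variables; the constraint can be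
  -- transferred because it contains no fresh constants.
  have hex : ∀ᶠ ι in U, ∃ L ∈ {L | L ∈ C.plits},
      litTrue L.1 (p ι fun k => (L.2 k).eval A ι₀ β) := by
    filter_upwards [hall] with ι hι
    have hτ : ∀ s n, ∃ t : Trm S K s, t.vars = ∅ ∧
        ((s, n) ∈ C.vars → t.eval A ι β = β s n) := by
      intro s n
      by_cases hx : (s, n) ∈ C.vars
      · obtain ⟨t, ht, he⟩ := hι _ hx
        exact ⟨t, ht, fun _ => he⟩
      · obtain ⟨t, ht⟩ := hgr s
        exact ⟨t, ht, fun h => absurd h hx⟩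
    choose τ hτ hτe using hτ
    have hsat := ((⟨A, p ι⟩ : PStruct S ar).sat_subst_ground ι β hτ C).1
      (hp ι _ (mem_groundInstances hC hτ)) fun L hL => by
        rw [L.2.holds_congr A ι (β' := β) fun x hx => hτe x.1 x.2 (Or.inl ⟨L, hL, hx⟩),
          L.2.holds_noFresh A ι ι₀ β ((hN C hC).1 L hL)]
        exact hφ L hL
    obtain ⟨L, hL, hLt⟩ := hsat
    refine ⟨L, hL, ?_⟩
    convert hLt using 3 with k
    obtain ⟨n, hn⟩ := (hN C hC).2 L hL k
    rw [hn]
    refine (hτe _ _ (Or.inr ⟨L, hL, k, ?_⟩)).symm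
    rw [hn]
    exact rfl
  have hfin : {L | L ∈ C.plits}.Finite := by
    classical
    exact C.plits.toFinset.finite_toSet.subset fun L hL => by simpa using hL
  -- An ultrafilter selects one of the finitely many literals that is true for almost all `ι`; it
  -- also commutes with negation, which handles negative literals.
  obtain ⟨L, hL, hLt⟩ := (Ultrafilter.eventually_exists_mem_iff hfin).1 hex
  refine ⟨L, hL, ?_⟩
  obtain ⟨b, x⟩ := L
  cases b
  · simp only [litTrue, Bool.false_eq_true, if_false] at hLt ⊢
    exact Ultrafilter.eventually_not.1 hLt
  · exact hLt

end Compactness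

end HRes

theorem mainTheorem1 {S : HRes.Signature.{u, w}} {ar : List S.Srt}
    {K : S.USort → Type v} (hK : ∀ j, Infinite (K j))
    (gt : HRes.Ob S K ar → HRes.Ob S K ar → Prop) (hgt : HRes.IsAdmissible gt)
    (T : Set (HRes.Struct S))
    (Rc : Set (HRes.Clause S K ar) → Set (HRes.Clause S K ar))
    (hRc : ∀ M, Rc M ⊆ HRes.standardRedundant T gt M)
    (N Nstar : Set (HRes.Clause S K ar)) (hN : ∀ C ∈ N, C.IsPClause)
    (hNstar : HRes.IsSaturationOf T gt Rc N Nstar)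
    (A : HRes.Struct S) (hA : A ∈ T) :
    A.Models (HRes.withoutP Nstar) ↔
      ∃ B : HRes.PStruct S ar, B.Models N ∧ B.toStruct = A := by
  constructor
  · intro hAM
    obtain ⟨p, hp⟩ := HRes.exists_models_of_forall_groundInstances hK A hN fun ι =>
      HRes.exists_expansion_of_saturation hgt hA (hRc Nstar) hN hNstar hAM ι fun s _ =>
        Classical.choice (match s with
          | .inl i => S.dom_nonempty i
          | .inr j => A.univ_nonempty j)
    exact ⟨⟨A, p⟩, hp, rfl⟩
  · rintro ⟨B, hB, rfl⟩ φ hφ ι β hc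
    obtain ⟨L, hL, -⟩ := (hNstar.derivable _ hφ).sound hB ι β hc
    exact Multiset.notMem_zero L hL
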